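/- All logarithms are to base $2$. **Hard distribution.** Let $k,\ell$ be natural numbers such that $k^{1/4^i}$ is an even integer for every $0\le i<\ell$, and put $n=k\sum_{i=0}^{\ell-1}4^i=k(4^\ell-1)/3$. A graph drawn from $G_{\mathrm{hard}}^{\mathrm{MM}}(k,\ell)$ has $n$ vertices, divided into levels $L_0,\dots,L_{\ell-1}$ with $|L_i|=4^ik$. The level $L_i$ is divided into $4^ik^{1-1/4^i}$ clusters of size $k^{1/4^i}$, each of which is a clique, and there are no other edges inside a level. A vertex of $L_i$ and a vertex of $L_j$ with $i<j$ are joined with probability $q_i=k^{1/4^i-1}/\log^2 n$, independently of all other pairs. **Algorithm ReduceMM.** Fix an ordering of the vertex pairs, and let $G_0=G$ and $\mathcal M=\emptyset$. In iteration $r=0,1,\dots$ the vertices of $G_r$ are divided into $1/p_r=\sqrt{d(G_r)}$ parts (rounded up to a positive integer), each vertex choosing its part independently and uniformly, where $d(G_r)$ is the average degree of $G_r$. In each part the lexicographically first maximal matching of the induced subgraph is computed, and these matchings are added to $\mathcal M$. A clean-up step then adds to $\mathcal M$ a further matching among the vertices still unmatched; it may be chosen in any way, possibly at random, depending on the input graph,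 the iteration, and the matchings found so far, and it has at most $n/\Delta(G_r)^{0.01}$ edges, where $\Delta(G_r)$ is the maximum degree of $G_r$ (it may be empty). Then $G_{r+1}=G[V\setminus V(\mathcal M)]$. The vertices of $G_r$ are called active. **Theorem.** There are constants $c>0$ and $k_0$ such that the following holds for all $k\ge k_0$ and $\ell=\lfloor\log(\log k)/20\rfloor$ for which $k^{1/4^i}$ is an even integer for all $0\le i<\ell$. Every graph of the distribution $G_{\mathrm{hard}}^{\mathrm{MM}}(k,\ell)$ has a perfect matching. Moreover, for every ordering of the vertex pairs and every clean-up rule as above, ReduceMM on $G\sim G_{\mathrm{hard}}^{\mathrm{MM}}(k,\ell)$ has the following properties. 1. It takes $\Omega(\log\log n)$ iterations: for every integer $0\le r\le c\log\log n$, with probability at least $1-2^{-2^{\sqrt{\log n}}}$ the matching after $r$ iterations is not a maximal matching of $G$. 2. For every integer $0\le r\le \ell/2$ and every $r\le j<\ell$, with probability at least $1-2^{-2^{\sqrt{\log n}}}$ the graph $G_r$ contains at least $$\left(4^j\cdot k\cdot\tfrac23\right)\left(1-\frac{10\,\ell\, r}{\log^2 n}\right)$$ vertices of $L_j$. -/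

import Mathlib

open scoped NNReal ENNReal

noncomputable section

namespace MMLower

/-! ## Probability -/

/-- Probability of an event under a discrete distribution. -/
def prob {α : Type} (p : PMF α) (E : Set α) : ℝ := (p.toOuterMeasure E).toReal

/-- The law of a family of independent coins, where coin `i` shows `true` with probability
`p i`. -/
def indepCoins {ι : Type} [Fintype ι] [DecidableEq ι] (p : ι → ℝ≥0) (hp : ∀ i, p i ≤ 1) :
    PMF (ι → Bool) :=
  PMF.ofFintype (fun f => ∏ i, (if f i = true then (p i : ℝ≥0∞) else 1 - (p i : ℝ≥0∞))) (by
    have h := Finset.prod_univ_sum (fun _ : ι => (Finset.univ : Finset Bool))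
      (fun i b => (if b = true then (p i : ℝ≥0∞) else 1 - (p i : ℝ≥0∞)))
    rw [Fintype.piFinset_univ] at h
    rw [← h]
    refine Finset.prod_eq_one fun i _ => ?_
    have h1 : (p i : ℝ≥0∞) ≤ 1 := by exact_mod_cast hp i
    simp [add_tsub_cancel_of_le h1])

/-! ## The hard graph distribution -/

/-- The number of vertices, `n = k * (4 ^ 0 + ⋯ + 4 ^ (ℓ - 1)) = k * (4 ^ ℓ - 1) / 3`. -/
def hardN (k ℓ : ℕ) : ℕ := k * ∑ i ∈ Finset.range ℓ, 4 ^ i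

/-- The size `k ^ (1 / 4 ^ i)` of the clusters of level `i` (used only where this real number is
an integer). -/
def clusterSize (k i : ℕ) : ℕ := ⌊(k : ℝ) ^ ((1 : ℝ) / 4 ^ i)⌋₊

/-- The number `4 ^ i * k ^ (1 - 1 / 4 ^ i)` of clusters of level `i`. -/
def numClusters (k i : ℕ) : ℕ := 4 ^ i * (k / clusterSize k i)

/-- A vertex is given by its level, its cluster in that level, and its place in the cluster. -/
abbrev HardVertex (k ℓ : ℕ) : Type :=
  Σ i : Fin ℓ, Fin (numClusters k i) × Fin (clusterSize k i)

/-- The level of a vertex. -/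
def level {k ℓ : ℕ} (v : HardVertex k ℓ) : ℕ := v.1

/-- `u` and `v` lie in the same cluster. -/
def SameCluster {k ℓ : ℕ} (u v : HardVertex k ℓ) : Prop :=
  level u = level v ∧ (u.2.1 : ℕ) = (v.2.1 : ℕ)

/-- `q_i = k ^ (1 / 4 ^ i - 1) / (log n) ^ 2`. -/
def edgeProb (k ℓ i : ℕ) : ℝ :=
  (k : ℝ) ^ ((1 : ℝ) / 4 ^ i - 1) / Real.logb 2 (hardN k ℓ) ^ 2

theorem edgeProb_le_one (k ℓ i : ℕ) : edgeProb k ℓ i ≤ 1 := by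
  unfold edgeProb
  rcases Nat.lt_or_ge (hardN k ℓ) 2 with h | h
  · have h0 : Real.logb 2 (hardN k ℓ) = 0 := by
      interval_cases (hardN k ℓ) <;> simp
    rw [h0]; simp
  · have hk : 1 ≤ k := by
      rcases Nat.eq_zero_or_pos k with rfl | hk
      · simp [hardN] at h
      · exact hk
    have h1 : (1 : ℝ) ≤ Real.logb 2 (hardN k ℓ) := by
      rw [Real.le_logb_iff_rpow_le (by norm_num) (by positivity)]
      simpa using (by exact_mod_cast h : (2 : ℝ) ≤ (hardN k ℓ : ℝ))
    have h2 : (1 : ℝ) ≤ Real.logb 2 (hardN k ℓ) ^ 2 := one_le_pow₀ h1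
    have h3 : (k : ℝ) ^ ((1 : ℝ) / 4 ^ i - 1) ≤ 1 := by
      refine Real.rpow_le_one_of_one_le_of_nonpos (by exact_mod_cast hk) ?_
      have h4 : (1 : ℝ) ≤ 4 ^ i := one_le_pow₀ (by norm_num)
      have h5 : (1 : ℝ) / 4 ^ i ≤ 1 := by
        rw [div_le_one (by positivity)]; exact h4
      linarith
    exact (div_le_one (by positivity)).mpr (h3.trans h2)

/-- The graph determined by the coin flips `ω`: every cluster is a clique, there is no other edge
inside a level, and a pair `u`, `v` with `level u < level v` is joined when its coin shows
`true`. -/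
def hardGraph {k ℓ : ℕ} (ω : HardVertex k ℓ × HardVertex k ℓ → Bool) :
    SimpleGraph (HardVertex k ℓ) where
  Adj u v := (u ≠ v ∧ SameCluster u v) ∨ (level u < level v ∧ ω (u, v) = true) ∨
    (level v < level u ∧ ω (v, u) = true)
  symm := ⟨by
    rintro u v (⟨h, h1, h2⟩ | h | h)
    · exact Or.inl ⟨h.symm, h1.symm, h2.symm⟩
    · exact Or.inr (Or.inr h)
    · exact Or.inr (Or.inl h)⟩
  loopless := ⟨by
    rintro u (⟨h, -⟩ | ⟨h, -⟩ | ⟨h, -⟩)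
    · exact h rfl
    · exact lt_irrefl _ h
    · exact lt_irrefl _ h⟩

/-- The hard distribution: the coins are independent, and the coin of `(u, v)` shows `true` with
probability `q_i`, where `i = level u`. -/
def hardMM (k ℓ : ℕ) : PMF (SimpleGraph (HardVertex k ℓ)) :=
  (indepCoins
    (fun e : HardVertex k ℓ × HardVertex k ℓ => (edgeProb k ℓ (level e.1)).toNNReal)
    (fun e => Real.toNNReal_le_one.mpr (edgeProb_le_one k ℓ (level e.1)))).map hardGraph

/-! ## Matchings and the algorithm -/

variable {V : Type}

/-- `M` is a matching of `G`. -/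
def IsMatchingOf (G : SimpleGraph V) (M : Finset (Sym2 V)) : Prop :=
  (∀ e ∈ M, e ∈ G.edgeSet) ∧ ∀ e ∈ M, ∀ f ∈ M, ∀ v, v ∈ e → v ∈ f → e = f

/-- `M` is an inclusion-maximal matching of `G`. -/
def IsMaximalMatchingOf (G : SimpleGraph V) (M : Finset (Sym2 V)) : Prop :=
  Maximal (IsMatchingOf G) M

/-- The active (unmatched) vertices `V \ V(M)`. -/
def active (M : Finset (Sym2 V)) : Set V := {v | ∀ e ∈ M, v ∉ e}

/-- The induced subgraph `G[A]`, as a graph on `V` in which the vertices outside `A` are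
isolated. -/
def restrict (G : SimpleGraph V) (A : Set V) : SimpleGraph V where
  Adj u v := u ∈ A ∧ v ∈ A ∧ G.Adj u v
  symm := ⟨fun _ _ h => ⟨h.2.1, h.1, h.2.2.symm⟩⟩
  loopless := ⟨fun _ h => G.loopless.irrefl _ h.2.2⟩

/-- The average degree `2 |E(G[A])| / |A|` of `G[A]`. -/
def avgDegree (G : SimpleGraph V) (A : Set V) : ℝ :=
  2 * ((restrict G A).edgeSet.ncard : ℝ) / (A.ncard : ℝ)

/-- The maximum degree. -/
def maxDeg [Fintype V] (H : SimpleGraph V) : ℕ :=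
  Finset.univ.sup fun v => (H.neighborSet v).ncard

open Classical in
/-- The lexicographically first maximal matching of `H`: go through the edges in the order `π` and
take an edge of `H` whenever it meets no edge taken before. -/
def lfmm (π : List (Sym2 V)) (H : SimpleGraph V) : Finset (Sym2 V) :=
  π.foldl (fun M e =>
    if e ∈ H.edgeSet ∧ (∀ v ∈ e, v ∈ active M) then insert e M else M) ∅

/-- The number `1 / p = √(d(G_r))` of parts, rounded up to a positive integer; here
`G_r = G[active M]`. -/
def numParts (G : SimpleGraph V) (M : Finset (Sym2 V)) : ℕ :=
  max 1 ⌈Real.sqrt (avgDegree G (active M))⌉₊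

instance (G : SimpleGraph V) (M : Finset (Sym2 V)) : NeZero (numParts G M) :=
  ⟨Nat.one_le_iff_ne_zero.mp (le_max_left _ _)⟩

open Classical in
/-- The union, over the parts `F_h = {v active | c v = h}`, of the lexicographically first maximal
matchings of `G[F_h]`. -/
def partMatching (π : List (Sym2 V)) (G : SimpleGraph V) (M : Finset (Sym2 V)) {N : ℕ}
    (c : V → Fin N) : Finset (Sym2 V) :=
  Finset.univ.biUnion fun h : Fin N => lfmm π (restrict G {v | v ∈ active M ∧ c v = h})

/-- A way to carry out the clean-up phase. Given the input graph `G`, the number `r` of the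
iteration, the matching `M` before the iteration and the union `M'` of the matchings computed on
the parts, it adds a (possibly random) matching `X` among the vertices that are still unmatched,
with at most `n / Δ ^ 0.01` edges, where `Δ` is the maximum degree of `G_r`. Nothing else is
required. -/
structure CleanUp (V : Type) [Fintype V] [DecidableEq V] where
  select : SimpleGraph V → ℕ → Finset (Sym2 V) → Finset (Sym2 V) → PMF (Finset (Sym2 V))
  isMatching : ∀ G r M M', ∀ X ∈ (select G r M M').support,
    IsMatchingOf (restrict G (active (M ∪ M'))) X
  card_le : ∀ G r M M', ∀ X ∈ (select G r M M').support,
    (X.card : ℝ) ≤ (Fintype.card V : ℝ) / (maxDeg (restrict G (active M)) : ℝ) ^ (0.01 : ℝ)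

/-- The algorithm without clean-up. -/
instance (V : Type) [Fintype V] [DecidableEq V] : Inhabited (CleanUp V) :=
  ⟨{ select := fun _ _ _ _ => PMF.pure ∅
     isMatching := by
      intro G r M M' X hX
      rw [PMF.mem_support_pure_iff] at hX
      subst hX
      simp [IsMatchingOf]
     card_le := by
      intro G r M M' X hX
      rw [PMF.mem_support_pure_iff] at hX
      subst hX
      simp only [Finset.card_empty, Nat.cast_zero]
      positivity }⟩

/-- Iteration `r`, started from the matching `M`: put every vertex into one of the parts,
independently and uniformly, add the matchings of the parts, and clean up. -/
def reduceStep [Fintype V] [DecidableEq V] (π : List (Sym2 V)) (C : CleanUp V)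
    (G : SimpleGraph V) (r : ℕ) (M : Finset (Sym2 V)) : PMF (Finset (Sym2 V)) :=
  (PMF.uniformOfFintype (V → Fin (numParts G M))).bind fun c =>
    (C.select G r M (partMatching π G M c)).map fun X => M ∪ partMatching π G M c ∪ X

/-- The law of the matching that the algorithm holds after `r` iterations on the input `G`, so that
`G_r` is the subgraph induced by the active vertices of this matching. -/
def reduceMM [Fintype V] [DecidableEq V] (π : List (Sym2 V)) (C : CleanUp V)
    (G : SimpleGraph V) : ℕ → PMF (Finset (Sym2 V))
  | 0 => PMF.pure ∅
  | r + 1 => (reduceMM π C G r).bind (reduceStep π C G r)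

/-- The joint law of a graph from the hard distribution and of the matching after `r` iterations
on it. -/
def hardRun (k ℓ : ℕ) (π : List (Sym2 (HardVertex k ℓ))) (C : CleanUp (HardVertex k ℓ)) (r : ℕ) :
    PMF (SimpleGraph (HardVertex k ℓ) × Finset (Sym2 (HardVertex k ℓ))) :=
  (hardMM k ℓ).bind fun G => (reduceMM π C G r).map fun M => (G, M)

/-- The number of active vertices of level `j`. -/
def activeInLevel {k ℓ : ℕ} (j : ℕ) (M : Finset (Sym2 (HardVertex k ℓ))) : ℕ :=
  {v : HardVertex k ℓ | v ∈ active M ∧ level v = j}.ncard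

/-- The probability bound `1 - 2 ^ (-2 ^ √(log n))`. -/
def highProb (n : ℕ) : ℝ :=
  1 - (2 : ℝ) ^ (-((2 : ℝ) ^ Real.sqrt (Real.logb 2 n)))

end MMLower

end

namespace MMLower

/-! ## Discrete probability -/

/-! The levels can be used up only one per iteration, from the bottom. Fewer than a third as many
vertices lie below level `j` as in it, so matching edges that go downwards cover less than a third
of level `j`. The invariant `StepInvariant` therefore only has to say that, after `r` iterations, in
every level `j ≥ r` few vertices are matched inside the level or upwards.

Iteration `r` preserves this for `j > r`. By the invariant at least half of level `r` is still
active. Its clusters are cliques of size `s_r`, so by Cauchy–Schwarz the average degree is at least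
`k * s_r / (8 * n)` (`degrees_of_half_active`). The number of parts is at least the square root of
this, and `s_r ≥ s_j ^ 4`, hence it far exceeds `s_j`. In a typical graph a vertex of level `j` has
at most `2 * s_j` forward neighbours (higher, or later in its cluster), so it rarely shares its part
with one. An edge inside a part that stays in level `j` or goes up from it has an end in level `j`
that shares its part with a forward neighbour, so such edges are few
(`card_sideMatched_partMatching_le`). The clean-up is small because the maximum degree is at least
`s_r / 4`. Of the greedy matchings only the matching property is used.

Concentration comes from union bounds over `t`-subsets (`choose_mul_pow_le`). They apply to the
colouring because forward edges are acyclic, so coincidences along chosen forward edges cost a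
factor `1 / N` each (`card_colorings_eq_le`). While half of level `r` is active, two active vertices
share a cluster, so the matching is not maximal. -/

theorem toOuterMeasure_bind_le {α β : Type} (p : PMF α) (f : α → PMF β) (E : Set β) (B : Set α)
    (ε : ℝ≥0∞) (h : ∀ a ∈ p.support, a ∉ B → (f a).toOuterMeasure E ≤ ε) :
    (p.bind f).toOuterMeasure E ≤ p.toOuterMeasure B + ε := by
  classical
  rw [PMF.toOuterMeasure_bind_apply, PMF.toOuterMeasure_apply]
  calc ∑' a, p a * (f a).toOuterMeasure E
      ≤ ∑' a, (B.indicator p a + p a * ε) := by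
        refine ENNReal.tsum_le_tsum fun a => ?_
        by_cases ha : a ∈ B
        · rw [Set.indicator_of_mem ha]
          refine le_trans ?_ le_self_add
          calc p a * (f a).toOuterMeasure E ≤ p a * 1 := by
                gcongr
                rw [PMF.toOuterMeasure_apply]
                calc _ ≤ ∑' b, f a b := ENNReal.tsum_le_tsum fun b => Set.indicator_le_self _ _ _
                  _ = 1 := (f a).tsum_coe
            _ = p a := mul_one _
        · by_cases hs : a ∈ p.support
          · refine le_trans ?_ le_add_self
            gcongr
            exact h a hs ha
          · have : p a = 0 := by simpa [PMF.mem_support_iff] using hs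
            simp [this]
    _ = _ := by
        rw [ENNReal.tsum_add, ENNReal.tsum_mul_right, p.tsum_coe, one_mul]

theorem one_sub_le_prob {α : Type} (p : PMF α) (E : Set α) {η : ℝ} (hη : 0 ≤ η)
    (h : p.toOuterMeasure Eᶜ ≤ ENNReal.ofReal η) : 1 - η ≤ prob p E := by
  have hle : ∀ F : Set α, p.toOuterMeasure F ≤ 1 := fun F => by
    rw [PMF.toOuterMeasure_apply]
    calc _ ≤ ∑' b, p b := ENNReal.tsum_le_tsum fun b => Set.indicator_le_self _ _ _
      _ = 1 := p.tsum_coe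
  have h1 : (1 : ℝ≥0∞) ≤ p.toOuterMeasure E + ENNReal.ofReal η := by
    calc (1 : ℝ≥0∞) = p.toOuterMeasure (E ∪ Eᶜ) := by
          rw [Set.union_compl_self, PMF.toOuterMeasure_apply]
          simp [p.tsum_coe]
      _ ≤ p.toOuterMeasure E + p.toOuterMeasure Eᶜ := MeasureTheory.measure_union_le _ _
      _ ≤ _ := by gcongr
  have hfin : p.toOuterMeasure E ≠ ∞ := ne_top_of_le_ne_top ENNReal.one_ne_top (hle E)
  have h2 := ENNReal.toReal_mono (ENNReal.add_ne_top.mpr ⟨hfin, ENNReal.ofReal_ne_top⟩) h1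
  rw [ENNReal.toReal_add hfin ENNReal.ofReal_ne_top, ENNReal.toReal_ofReal hη] at h2
  unfold prob
  simp only [ENNReal.toReal_one] at h2
  linarith

/-- The probability that all coins of `S` show `true`. -/
theorem indepCoins_forall_le {ι : Type} [Fintype ι] [DecidableEq ι] (p : ι → ℝ≥0)
    (hp : ∀ i, p i ≤ 1) (S : Finset ι) :
    (indepCoins p hp).toOuterMeasure {f | ∀ i ∈ S, f i = true} ≤ ∏ i ∈ S, (p i : ℝ≥0∞) := by
  classical
  rw [PMF.toOuterMeasure_apply_fintype]
  -- Giving `false` weight zero on `S` builds the event into the product, so the sum over all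
  -- outcomes factors coin by coin.
  set g : ι → Bool → ℝ≥0∞ := fun i b =>
    if i ∈ S ∧ b = false then 0 else if b = true then (p i : ℝ≥0∞) else 1 - (p i : ℝ≥0∞) with hg
  have h1 : ∀ f : ι → Bool,
      Set.indicator {f | ∀ i ∈ S, f i = true} (indepCoins p hp) f ≤ ∏ i, g i (f i) := by
    intro f
    by_cases hf : f ∈ {f : ι → Bool | ∀ i ∈ S, f i = true}
    · rw [Set.indicator_of_mem hf]
      refine le_of_eq ?_
      simp only [indepCoins, PMF.ofFintype_apply]
      refine Finset.prod_congr rfl fun i _ => ?_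
      have : ¬ (i ∈ S ∧ f i = false) := fun h => by simp [hf i h.1] at h
      simp [hg, this]
    · rw [Set.indicator_of_notMem hf]; exact zero_le
  calc _ ≤ ∑ f : ι → Bool, ∏ i, g i (f i) := Finset.sum_le_sum fun f _ => h1 f
    _ = ∏ i, ∑ b, g i b := by
        rw [Finset.prod_univ_sum, Fintype.piFinset_univ]
    _ = ∏ i, (if i ∈ S then (p i : ℝ≥0∞) else 1) := by
        refine Finset.prod_congr rfl fun i _ => ?_
        have h2 : (p i : ℝ≥0∞) ≤ 1 := by exact_mod_cast hp i
        by_cases hi : i ∈ S <;> simp [hg, hi, add_tsub_cancel_of_le h2]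
    _ = ∏ i ∈ S, (p i : ℝ≥0∞) := by
        rw [Finset.prod_ite_mem, Finset.univ_inter]

/-- The probability that at least `t` coins of `T` show `true`. -/
theorem indepCoins_card_ge_le {ι : Type} [Fintype ι] [DecidableEq ι] (p : ι → ℝ≥0)
    (hp : ∀ i, p i ≤ 1) (T : Finset ι) (q : ℝ≥0) (hq : ∀ i ∈ T, p i ≤ q) (t : ℕ) :
    (indepCoins p hp).toOuterMeasure {f | t ≤ (T.filter fun i => f i = true).card} ≤
      (T.card.choose t : ℝ≥0∞) * (q : ℝ≥0∞) ^ t := by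
  classical
  calc _ ≤ (indepCoins p hp).toOuterMeasure
          (⋃ S ∈ T.powersetCard t, {f | ∀ i ∈ S, f i = true}) := by
        refine MeasureTheory.measure_mono fun f hf => ?_
        obtain ⟨S, hS, hc⟩ := Finset.exists_subset_card_eq (Set.mem_ofPred_eq ▸ hf)
        simp only [Set.mem_iUnion, Finset.mem_powersetCard]
        refine ⟨S, ⟨hS.trans (Finset.filter_subset _ _), hc⟩, fun i hi => ?_⟩
        exact (Finset.mem_filter.mp (hS hi)).2
    _ ≤ ∑ S ∈ T.powersetCard t, (indepCoins p hp).toOuterMeasure {f | ∀ i ∈ S, f i = true} :=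
        MeasureTheory.measure_biUnion_finset_le _ _
    _ ≤ ∑ S ∈ T.powersetCard t, (q : ℝ≥0∞) ^ t := by
        refine Finset.sum_le_sum fun S hS => ?_
        rw [Finset.mem_powersetCard] at hS
        refine (indepCoins_forall_le p hp S).trans ?_
        calc ∏ i ∈ S, (p i : ℝ≥0∞) ≤ ∏ i ∈ S, (q : ℝ≥0∞) :=
              Finset.prod_le_prod' fun i hi => by exact_mod_cast hq i (hS.1 hi)
          _ = _ := by rw [Finset.prod_const, hS.2]
    _ = _ := by rw [Finset.sum_const, Finset.card_powersetCard, nsmul_eq_mul]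

/-- Colourings in which the colour of every `u ∈ S` is that of `f u`, for a function `f` that
increases a rank, are determined by their values outside `S`. -/
theorem card_colorings_eq_le {V : Type} [Fintype V] [DecidableEq V] (N : ℕ) (S : Finset V)
    (f : V → V) (ρ : V → ℕ) (hf : ∀ u ∈ S, ρ u < ρ (f u)) :
    (Finset.univ.filter fun c : V → Fin N => ∀ u ∈ S, c u = c (f u)).card * N ^ S.card ≤
      N ^ Fintype.card V := by
  classical
  have key : (Finset.univ.filter fun c : V → Fin N => ∀ u ∈ S, c u = c (f u)).card ≤
      N ^ (Sᶜ).card := by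
    have h1 : Fintype.card ((Sᶜ : Finset V) → Fin N) = N ^ (Sᶜ).card := by simp [Finset.card_compl]
    rw [← h1, ← Finset.card_univ]
    refine Finset.card_le_card_of_injOn (fun c v => c v) (fun _ _ => Finset.mem_univ _) ?_
    intro c hc c' hc' heq
    simp only [Finset.coe_filter, Finset.mem_univ, true_and, Set.mem_ofPred_eq] at hc hc'
    have hout : ∀ v, v ∉ S → c v = c' v := fun v hv =>
      congrFun heq ⟨v, Finset.mem_compl.mpr hv⟩
    obtain ⟨R, hR⟩ : ∃ R, ∀ v, ρ v ≤ R :=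
      ⟨Finset.univ.sup ρ, fun v => Finset.le_sup (Finset.mem_univ v)⟩
    -- Induction from the highest rank downwards: the colour of `v ∈ S` is that of `f v`, whose rank
    -- is larger.
    have : ∀ d v, R - ρ v ≤ d → c v = c' v := by
      intro d
      induction d with
      | zero =>
        intro v hv
        refine hout v fun hS => ?_
        have := hf v hS
        have := hR (f v)
        omega
      | succ d ih =>
        intro v hv
        by_cases hS : v ∈ S
        · rw [hc v hS, hc' v hS]
          have := hf v hS
          have := hR (f v)
          exact ih _ (by omega)
        · exact hout v hS
    exact funext fun v => this _ v le_rfl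
  calc _ ≤ N ^ (Sᶜ).card * N ^ S.card := Nat.mul_le_mul_right _ key
    _ = _ := by rw [← pow_add, Finset.card_compl_add_card]

/-- A union bound over the choice of a witness `f u ∈ nb u` for each `u ∈ S`. There are at most `D ^
|S|` choices, and each is handled by `card_colorings_eq_le`. -/
theorem card_colorings_exists_le {V : Type} [Fintype V] [DecidableEq V] (N D : ℕ)
    (S : Finset V) (nb : V → Finset V) (ρ : V → ℕ) (hρ : ∀ u, ∀ v ∈ nb u, ρ u < ρ v)
    (hD : ∀ u ∈ S, (nb u).card ≤ D) :
    (Finset.univ.filter fun c : V → Fin N => ∀ u ∈ S, ∃ v ∈ nb u, c u = c v).card * N ^ S.card ≤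
      D ^ S.card * N ^ Fintype.card V := by
  classical
  -- Witness functions are frozen to the identity outside `S`, so that only the choices on `S` are
  -- counted.
  set F : Finset (V → V) := Fintype.piFinset fun u => if u ∈ S then nb u else {u}
  have hF : F.card ≤ D ^ S.card := by
    rw [Fintype.card_piFinset]
    calc ∏ u, (if u ∈ S then nb u else {u}).card ≤ ∏ u, (if u ∈ S then D else 1) := by
          refine Finset.prod_le_prod' fun u _ => ?_
          by_cases hu : u ∈ S <;> simp [hu, hD]
      _ = D ^ S.card := by rw [Finset.prod_ite_mem, Finset.univ_inter, Finset.prod_const]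
  have hsub : (Finset.univ.filter fun c : V → Fin N => ∀ u ∈ S, ∃ v ∈ nb u, c u = c v) ⊆
      F.biUnion fun f => Finset.univ.filter fun c : V → Fin N =>
        ∀ u ∈ S, c u = c (f u) ∧ f u ∈ nb u := by
    intro c hc
    simp only [Finset.mem_filter, Finset.mem_univ, true_and] at hc
    choose! f hf hcf using hc
    simp only [Finset.mem_biUnion, Finset.mem_filter, Finset.mem_univ, true_and]
    refine ⟨fun u => if u ∈ S then f u else u, ?_, fun u hu => ?_⟩
    · rw [Fintype.mem_piFinset]
      intro u
      by_cases hu : u ∈ S <;> simp [hu, hf]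
    · simp only [hu, if_true]
      exact ⟨hcf u hu, hf u hu⟩
  calc _ ≤ (∑ f ∈ F, (Finset.univ.filter fun c : V → Fin N =>
        ∀ u ∈ S, c u = c (f u) ∧ f u ∈ nb u).card) * N ^ S.card :=
        Nat.mul_le_mul_right _ ((Finset.card_le_card hsub).trans Finset.card_biUnion_le)
    _ = ∑ f ∈ F, (Finset.univ.filter fun c : V → Fin N =>
        ∀ u ∈ S, c u = c (f u) ∧ f u ∈ nb u).card * N ^ S.card := Finset.sum_mul _ _ _
    _ ≤ ∑ f ∈ F, N ^ Fintype.card V := by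
        refine Finset.sum_le_sum fun f hf => ?_
        rw [Fintype.mem_piFinset] at hf
        refine le_trans (Nat.mul_le_mul_right _ (Finset.card_le_card ?_))
          (card_colorings_eq_le N S f ρ fun u hu => hρ u _ ?_)
        · intro c hc
          simp only [Finset.mem_filter, Finset.mem_univ, true_and] at hc ⊢
          exact fun u hu => (hc u hu).1
        · simpa [hu] using hf u
    _ = F.card * N ^ Fintype.card V := by rw [Finset.sum_const, smul_eq_mul]
    _ ≤ _ := Nat.mul_le_mul_right _ hF

open Classical in
/-- In a uniformly random colouring with `N` colours, the probability that at least `t` vertices of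
`T` have the colour of one of their at most `D` later neighbours. -/
theorem uniform_card_bad_ge_le {V : Type} [Fintype V] (N D : ℕ) [NeZero N]
    (T : Finset V) (nb : V → Finset V) (ρ : V → ℕ) (hρ : ∀ u, ∀ v ∈ nb u, ρ u < ρ v)
    (hD : ∀ u ∈ T, (nb u).card ≤ D) (t : ℕ) :
    (PMF.uniformOfFintype (V → Fin N)).toOuterMeasure
        {c | t ≤ (T.filter fun u => ∃ v ∈ nb u, c u = c v).card} ≤
      ENNReal.ofReal ((T.card.choose t : ℝ) * ((D : ℝ) / N) ^ t) := by
  have hN : (0 : ℝ) < N := by exact_mod_cast Nat.pos_of_ne_zero (NeZero.ne N)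
  have one : ∀ S ∈ T.powersetCard t, (PMF.uniformOfFintype (V → Fin N)).toOuterMeasure
      {c | ∀ u ∈ S, ∃ v ∈ nb u, c u = c v} ≤ ENNReal.ofReal (((D : ℝ) / N) ^ t) := by
    intro S hS
    rw [Finset.mem_powersetCard] at hS
    have h := card_colorings_exists_le N D S nb ρ hρ fun u hu => hD u (hS.1 hu)
    rw [hS.2] at h
    rw [PMF.toOuterMeasure_uniformOfFintype_apply]
    have hc : Fintype.card (V → Fin N) = N ^ Fintype.card V := by simp
    rw [hc, Fintype.card_ofFinset
      (Finset.univ.filter fun c : V → Fin N => ∀ u ∈ S, ∃ v ∈ nb u, c u = c v) (by simp)]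
    set X := (Finset.univ.filter fun c : V → Fin N => ∀ u ∈ S, ∃ v ∈ nb u, c u = c v).card
    have hX : (X : ℝ) * (N : ℝ) ^ t ≤ (D : ℝ) ^ t * (N : ℝ) ^ Fintype.card V := by exact_mod_cast h
    have e1 : ((X : ℝ≥0∞) / ((N ^ Fintype.card V : ℕ) : ℝ≥0∞)) =
        ENNReal.ofReal ((X : ℝ) / (N : ℝ) ^ Fintype.card V) := by
      rw [ENNReal.ofReal_div_of_pos (by positivity), ENNReal.ofReal_natCast,
        ← Nat.cast_pow, ENNReal.ofReal_natCast]
    rw [e1]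
    refine ENNReal.ofReal_le_ofReal ?_
    rw [div_pow, div_le_div_iff₀ (by positivity) (by positivity)]
    exact hX
  -- At least `t` bad vertices contain a set of exactly `t` bad ones; the union bound runs over
  -- these sets.
  calc _ ≤ (PMF.uniformOfFintype (V → Fin N)).toOuterMeasure
          (⋃ S ∈ T.powersetCard t, {c | ∀ u ∈ S, ∃ v ∈ nb u, c u = c v}) := by
        refine MeasureTheory.measure_mono fun f hf => ?_
        obtain ⟨S, hS, hc⟩ := Finset.exists_subset_card_eq (Set.mem_ofPred_eq ▸ hf)
        simp only [Set.mem_iUnion, Finset.mem_powersetCard]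
        refine ⟨S, ⟨hS.trans (Finset.filter_subset _ _), hc⟩, fun i hi => ?_⟩
        exact (Finset.mem_filter.mp (hS hi)).2
    _ ≤ ∑ S ∈ T.powersetCard t, (PMF.uniformOfFintype (V → Fin N)).toOuterMeasure
          {c | ∀ u ∈ S, ∃ v ∈ nb u, c u = c v} := MeasureTheory.measure_biUnion_finset_le _ _
    _ ≤ ∑ S ∈ T.powersetCard t, ENNReal.ofReal (((D : ℝ) / N) ^ t) := Finset.sum_le_sum one
    _ = _ := by
        rw [Finset.sum_const, Finset.card_powersetCard, nsmul_eq_mul,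
          ENNReal.ofReal_mul (by positivity), ENNReal.ofReal_natCast]

/-- Serves in place of a Chernoff bound. Since `t ^ t / t! ≤ e ^ t ≤ 3 ^ t`, a threshold of six
times the mean `m * x` leaves `(3 / 6) ^ t`. -/
theorem choose_mul_pow_le (m t : ℕ) (x : ℝ) (hx : 0 ≤ x) (h : 6 * (m * x) ≤ t) :
    (m.choose t : ℝ) * x ^ t ≤ (1 / 2) ^ t := by
  have h1 : (m.choose t : ℝ) ≤ (m : ℝ) ^ t / (t.factorial : ℝ) := Nat.choose_le_pow_div t m
  have h2 : (t : ℝ) ^ t / (t.factorial : ℝ) ≤ Real.exp t :=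
    Real.pow_div_factorial_le_exp _ (by positivity) t
  have h3 : Real.exp t ≤ 3 ^ t := by
    rw [← mul_one (t : ℝ), Real.exp_nat_mul]
    gcongr
    linarith [Real.exp_one_lt_d9]
  have h4 : (6 * (m * x)) ^ t ≤ (t : ℝ) ^ t := by gcongr
  calc (m.choose t : ℝ) * x ^ t ≤ (m : ℝ) ^ t / (t.factorial : ℝ) * x ^ t := by gcongr
    _ = (6 * (m * x)) ^ t / (t.factorial : ℝ) * (1 / 6) ^ t := by
        rw [mul_pow 6, mul_pow, one_div, inv_pow]; field_simp
    _ ≤ (t : ℝ) ^ t / (t.factorial : ℝ) * (1 / 6) ^ t := by gcongr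
    _ ≤ 3 ^ t * (1 / 6) ^ t := by gcongr; exact h2.trans h3
    _ = _ := by rw [← mul_pow]; norm_num

end MMLower

namespace MMLower

/-! ## Levels and clusters -/

theorem clusterSize_eq {k i s : ℕ} (h : s ^ 4 ^ i = k) : clusterSize k i = s := by
  unfold clusterSize
  have h1 : (k : ℝ) ^ ((1 : ℝ) / 4 ^ i) = s := by
    rw [← h, one_div]
    have := Real.pow_rpow_inv_natCast (x := (s : ℝ)) (n := 4 ^ i) (by positivity) (by positivity)
    push_cast at this ⊢
    exact this
  rw [h1, Nat.floor_natCast]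

theorem clusterSize_pow {k i : ℕ} (h : ∃ s : ℕ, Even s ∧ s ^ 4 ^ i = k) :
    clusterSize k i ^ 4 ^ i = k := by
  obtain ⟨s, -, hs⟩ := h
  rw [clusterSize_eq hs, hs]

theorem even_clusterSize {k i : ℕ} (h : ∃ s : ℕ, Even s ∧ s ^ 4 ^ i = k) :
    Even (clusterSize k i) := by
  obtain ⟨s, he, hs⟩ := h
  rwa [clusterSize_eq hs]

theorem numClusters_mul_clusterSize {k i : ℕ} (h : clusterSize k i ^ 4 ^ i = k) :
    numClusters k i * clusterSize k i = 4 ^ i * k := by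
  have hd : clusterSize k i ∣ k := by
    conv_rhs => rw [← h]
    exact dvd_pow_self _ (by positivity)
  rw [numClusters, mul_assoc, Nat.div_mul_cancel hd]

variable {k ℓ : ℕ}

theorem level_lt (v : HardVertex k ℓ) : level v < ℓ := v.1.2

/-- The place of a vertex in its cluster. -/
def place (v : HardVertex k ℓ) : ℕ := v.2.2

/-- The number of the cluster of a vertex within its level. -/
def clusterOf (v : HardVertex k ℓ) : ℕ := v.2.1

theorem place_lt (v : HardVertex k ℓ) : place v < clusterSize k (level v) := v.2.2.2

theorem clusterOf_lt (v : HardVertex k ℓ) : clusterOf v < numClusters k (level v) := v.2.1.2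

theorem hardVertex_ext {u v : HardVertex k ℓ} (h1 : level u = level v)
    (h2 : clusterOf u = clusterOf v) (h3 : place u = place v) : u = v := by
  obtain ⟨i, a, b⟩ := u
  obtain ⟨i', a', b'⟩ := v
  obtain rfl : i = i' := Fin.ext h1
  obtain rfl : a = a' := Fin.ext h2
  obtain rfl : b = b' := Fin.ext h3
  rfl

/-- The vertex with given coordinates. -/
noncomputable def mkVertex {i a b : ℕ} (hi : i < ℓ) (ha : a < numClusters k i) (hb : b < clusterSize k i) :
    HardVertex k ℓ := ⟨⟨i, hi⟩, ⟨a, ha⟩, ⟨b, hb⟩⟩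

/-- The vertices of level `j`. -/
noncomputable def levelSet (k ℓ j : ℕ) : Finset (HardVertex k ℓ) := Finset.univ.filter fun v => level v = j

/-- The cluster `a` of level `j`. -/
noncomputable def clusterSet (k ℓ j a : ℕ) : Finset (HardVertex k ℓ) :=
  Finset.univ.filter fun v => level v = j ∧ clusterOf v = a

@[simp] theorem mem_levelSet {j : ℕ} {v : HardVertex k ℓ} : v ∈ levelSet k ℓ j ↔ level v = j := by
  simp [levelSet]

@[simp] theorem mem_clusterSet {j a : ℕ} {v : HardVertex k ℓ} :
    v ∈ clusterSet k ℓ j a ↔ level v = j ∧ clusterOf v = a := by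
  simp [clusterSet]

theorem card_clusterSet_le (j a : ℕ) : (clusterSet k ℓ j a).card ≤ clusterSize k j := by
  rw [← Finset.card_range (clusterSize k j)]
  refine Finset.card_le_card_of_injOn place ?_ ?_
  · intro v hv
    rw [Finset.mem_coe, mem_clusterSet] at hv
    have := place_lt v
    rw [hv.1] at this
    simpa using this
  · intro u hu v hv h
    rw [Finset.mem_coe, mem_clusterSet] at hu hv
    exact hardVertex_ext (hu.1.trans hv.1.symm) (hu.2.trans hv.2.symm) h

theorem card_levelSet {j : ℕ} (hj : j < ℓ) (hs : clusterSize k j ^ 4 ^ j = k) :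
    (levelSet k ℓ j).card = 4 ^ j * k := by
  rw [← numClusters_mul_clusterSize hs]
  have h1 : (Finset.univ : Finset (Fin (numClusters k j) × Fin (clusterSize k j))).card =
      numClusters k j * clusterSize k j := by simp
  rw [← h1]
  symm
  refine Finset.card_bij (fun x _ => (⟨⟨j, hj⟩, x⟩ : HardVertex k ℓ)) ?_ ?_ ?_
  · intro x _; simp [level]
  · intro x _ y _ h
    simpa using h
  · rintro ⟨i, x⟩ hv
    rw [mem_levelSet] at hv
    obtain rfl : i = ⟨j, hj⟩ := Fin.ext hv
    exact ⟨x, Finset.mem_univ _, rfl⟩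

theorem card_filter_level_lt {j : ℕ} (hj : j ≤ ℓ) (hs : ∀ i < ℓ, clusterSize k i ^ 4 ^ i = k) :
    (Finset.univ.filter fun v : HardVertex k ℓ => level v < j).card = hardN k j := by
  classical
  rw [Finset.card_eq_sum_card_fiberwise (f := level) (t := Finset.range j)
    (fun v hv => by simpa using hv), hardN, Finset.mul_sum]
  refine Finset.sum_congr rfl fun i hi => ?_
  have hij : i < j := Finset.mem_range.mp hi
  rw [mul_comm, ← card_levelSet (hij.trans_le hj) (hs i (hij.trans_le hj))]
  congr 1
  ext v
  simp only [Finset.mem_filter, Finset.mem_univ, true_and, mem_levelSet]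
  constructor
  · exact fun h => h.2
  · exact fun h => ⟨h ▸ hij, h⟩

theorem card_hardVertex (hs : ∀ i < ℓ, clusterSize k i ^ 4 ^ i = k) :
    Fintype.card (HardVertex k ℓ) = hardN k ℓ := by
  rw [← card_filter_level_lt le_rfl hs, ← Finset.card_univ]
  congr 1
  ext v
  simp [level_lt]

theorem three_mul_hardN_add (k j : ℕ) : 3 * hardN k j + k = 4 ^ j * k := by
  induction j with
  | zero => simp [hardN]
  | succ j ih =>
    unfold hardN at ih ⊢
    rw [Finset.sum_range_succ, pow_succ]
    linarith

/-! ## Perfect matchings -/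

/-- Clusters are cliques of even size, so the places `2a` and `2a + 1` of each cluster can be
paired. -/
theorem exists_perfectMatching (hev : ∀ i < ℓ, Even (clusterSize k i))
    {G : SimpleGraph (HardVertex k ℓ)}
    (hG : ∀ u v, u ≠ v → SameCluster u v → G.Adj u v) :
    ∃ P : G.Subgraph, P.IsPerfectMatching := by
  refine ⟨{ verts := Set.univ
            Adj := fun u v => u ≠ v ∧ SameCluster u v ∧ place u / 2 = place v / 2
            adj_sub := fun h => hG _ _ h.1 h.2.1
            edge_vert := fun _ => Set.mem_univ _
            symm := ⟨fun u v h => ⟨h.1.symm, ⟨h.2.1.1.symm, h.2.1.2.symm⟩, h.2.2.symm⟩⟩ },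
    fun v _ => ?_, fun v => Set.mem_univ v⟩
  obtain ⟨m, hm⟩ := hev _ (level_lt v)
  have hv := place_lt v
  have key : ∃ b, b < clusterSize k (level v) ∧ b ≠ place v ∧ place v / 2 = b / 2 := by
    rcases Nat.even_or_odd' (place v) with ⟨a, ha | ha⟩
    · exact ⟨place v + 1, by omega, by omega, by omega⟩
    · exact ⟨place v - 1, by omega, by omega, by omega⟩
  obtain ⟨b, hb, hbv, hb2⟩ := key
  refine ⟨mkVertex (level_lt v) (clusterOf_lt v) hb, ⟨?_, ⟨rfl, rfl⟩, hb2⟩, ?_⟩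
  · intro h
    exact hbv (congrArg place h).symm
  · rintro w ⟨hw1, hw2, hw3⟩
    refine hardVertex_ext hw2.1.symm hw2.2.symm ?_
    change place w = b
    have hne : place w ≠ place v := fun h => hw1 (hardVertex_ext hw2.1 hw2.2 h.symm)
    omega

/-! ## Typical graphs -/

/-- The structure of a typical graph of the hard distribution: clusters are cliques, the other
edges join different levels, and a vertex of level `i` has fewer than `k ^ (1 / 4 ^ i)` neighbours
in higher levels. -/
structure IsTypical (G : SimpleGraph (HardVertex k ℓ)) : Prop where
  adj : ∀ u v, u ≠ v → SameCluster u v → G.Adj u v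
  sameCluster : ∀ u v, G.Adj u v → level u = level v → SameCluster u v
  upper : ∀ u, {v | level u < level v ∧ G.Adj u v}.ncard < clusterSize k (level u)

theorem hardGraph_adj_of_sameCluster (ω : HardVertex k ℓ × HardVertex k ℓ → Bool)
    {u v : HardVertex k ℓ} (h : u ≠ v) (hs : SameCluster u v) : (hardGraph ω).Adj u v :=
  Or.inl ⟨h, hs⟩

theorem adj_of_mem_support_hardMM {G : SimpleGraph (HardVertex k ℓ)}
    (hG : G ∈ (hardMM k ℓ).support) {u v : HardVertex k ℓ} (h : u ≠ v) (hs : SameCluster u v) :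
    G.Adj u v := by
  obtain ⟨ω, -, rfl⟩ := (PMF.mem_support_map_iff _ _ _).mp hG
  exact hardGraph_adj_of_sameCluster ω h hs

theorem isTypical_hardGraph {ω : HardVertex k ℓ × HardVertex k ℓ → Bool}
    (h : ∀ u : HardVertex k ℓ,
      ((({u} : Finset _) ×ˢ Finset.univ.filter fun v => level u < level v).filter
        fun e => ω e = true).card < clusterSize k (level u)) : IsTypical (hardGraph ω) where
  adj _ _ := hardGraph_adj_of_sameCluster ω
  sameCluster := by
    rintro u v (⟨-, h⟩ | ⟨h, -⟩ | ⟨h, -⟩) hl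
    · exact h
    · omega
    · omega
  upper u := by
    refine lt_of_le_of_lt ?_ (h u)
    rw [← Set.ncard_coe_finset]
    refine Set.ncard_le_ncard_of_injOn (fun v => (u, v)) ?_ (by simp [Set.InjOn])
    rintro v ⟨hl, ⟨-, h⟩ | ⟨h, h'⟩ | ⟨h, -⟩⟩
    · exact absurd h.1 hl.ne
    · simp only [Finset.coe_filter, Finset.mem_product, Finset.mem_singleton, Finset.mem_filter,
        Finset.mem_univ, true_and, Set.mem_ofPred_eq]
      exact ⟨h, h'⟩
    · omega

/-- A graph of the hard distribution is typical with high probability. -/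
theorem hardMM_not_isTypical_le {η : ℝ} (hs : ∀ i < ℓ, clusterSize k i ^ 4 ^ i = k)
    (hq : ∀ i < ℓ, 6 * (hardN k ℓ * edgeProb k ℓ i) ≤ clusterSize k i)
    (hη : ∀ i < ℓ, hardN k ℓ * (1 / 2 : ℝ) ^ clusterSize k i ≤ η) :
    (hardMM k ℓ).toOuterMeasure {G | ¬ IsTypical G} ≤ ENNReal.ofReal η := by
  classical
  -- The union bound below allots `η / n` to each vertex, which needs `n ≠ 0`.
  rcases Nat.eq_zero_or_pos (hardN k ℓ) with h0 | hpos
  · have hem : IsEmpty (HardVertex k ℓ) := Fintype.card_eq_zero_iff.mp (by rw [card_hardVertex hs, h0])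
    have : {G : SimpleGraph (HardVertex k ℓ) | ¬ IsTypical G} = ∅ := by
      ext G
      simp only [Set.mem_ofPred_eq, Set.mem_empty_iff_false, iff_false, not_not]
      exact ⟨fun u => (hem.false u).elim, fun u => (hem.false u).elim, fun u => (hem.false u).elim⟩
    rw [this]; simp
  have hq0 : ∀ i, 0 ≤ edgeProb k ℓ i := fun i => by unfold edgeProb; positivity
  rw [hardMM, PMF.toOuterMeasure_map_apply]
  set P := indepCoins (fun e : HardVertex k ℓ × HardVertex k ℓ =>
    (edgeProb k ℓ (level e.1)).toNNReal)
    (fun e => Real.toNNReal_le_one.mpr (edgeProb_le_one k ℓ (level e.1))) with hP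
  set T : HardVertex k ℓ → Finset (HardVertex k ℓ × HardVertex k ℓ) := fun u =>
    ({u} : Finset _) ×ˢ Finset.univ.filter fun v => level u < level v with hT
  have one : ∀ u : HardVertex k ℓ,
      P.toOuterMeasure {ω | clusterSize k (level u) ≤ ((T u).filter fun e => ω e = true).card} ≤
        ENNReal.ofReal (η / hardN k ℓ) := by
    intro u
    refine (indepCoins_card_ge_le _ _ (T u) (edgeProb k ℓ (level u)).toNNReal ?_ _).trans ?_
    · intro e he
      simp only [hT, Finset.mem_product, Finset.mem_singleton] at he
      rw [he.1]
    have hcard : (T u).card ≤ hardN k ℓ := by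
      rw [← card_hardVertex hs, hT, Finset.card_product, Finset.card_singleton, one_mul]
      exact Finset.card_le_univ _
    set t := clusterSize k (level u)
    set q := edgeProb k ℓ (level u)
    have e1 : (((T u).card.choose t : ℕ) : ℝ≥0∞) * ((q.toNNReal : ℝ≥0) : ℝ≥0∞) ^ t =
        ENNReal.ofReal (((T u).card.choose t : ℝ) * q ^ t) := by
      rw [ENNReal.ofReal_mul (by positivity), ENNReal.ofReal_natCast,
        ENNReal.ofReal_pow (hq0 _)]
      rfl
    rw [e1]
    refine ENNReal.ofReal_le_ofReal ?_
    refine (choose_mul_pow_le _ _ _ (hq0 _) ?_).trans ?_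
    · refine le_trans ?_ (hq _ (level_lt u))
      have : ((T u).card : ℝ) ≤ hardN k ℓ := by exact_mod_cast hcard
      have := hq0 (level u)
      gcongr
    · rw [le_div_iff₀ (by exact_mod_cast hpos), mul_comm]
      exact hη _ (level_lt u)
  calc _ ≤ P.toOuterMeasure (⋃ u ∈ (Finset.univ : Finset (HardVertex k ℓ)),
        {ω | clusterSize k (level u) ≤ ((T u).filter fun e => ω e = true).card}) := by
        refine MeasureTheory.measure_mono fun ω hω => ?_
        by_contra hcon
        refine hω (isTypical_hardGraph fun u => ?_)
        by_contra hu
        refine hcon ?_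
        simp only [Set.mem_iUnion]
        exact ⟨u, Finset.mem_univ u, not_lt.mp hu⟩
    _ ≤ ∑ u, P.toOuterMeasure
        {ω | clusterSize k (level u) ≤ ((T u).filter fun e => ω e = true).card} :=
        MeasureTheory.measure_biUnion_finset_le _ _
    _ ≤ ∑ u : HardVertex k ℓ, ENNReal.ofReal (η / hardN k ℓ) :=
        Finset.sum_le_sum fun u _ => one u
    _ = ENNReal.ofReal η := by
        rw [Finset.sum_const, Finset.card_univ, card_hardVertex hs, nsmul_eq_mul,
          ← ENNReal.ofReal_natCast, ← ENNReal.ofReal_mul (by positivity)]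
        congr 1
        have : (hardN k ℓ : ℝ) ≠ 0 := by exact_mod_cast hpos.ne'
        field_simp

end MMLower

namespace MMLower

/-! ## Matchings -/

section Matchings

variable {V : Type} {G H : SimpleGraph V} {M M' : Finset (Sym2 V)}

theorem isMatchingOf_empty (G : SimpleGraph V) : IsMatchingOf G ∅ := by simp [IsMatchingOf]

theorem mem_of_mem_edgeSet_restrict {A : Set V} {e : Sym2 V}
    (he : e ∈ (restrict G A).edgeSet) : e ∈ G.edgeSet ∧ ∀ v ∈ e, v ∈ A := by
  induction e using Sym2.ind with
  | _ a b =>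
    rw [SimpleGraph.mem_edgeSet] at he
    refine ⟨he.2.2, fun v hv => ?_⟩
    rcases Sym2.mem_iff.mp hv with rfl | rfl
    · exact he.1
    · exact he.2.1

theorem mem_edgeSet_restrict {A : Set V} {e : Sym2 V} (he : e ∈ G.edgeSet)
    (hA : ∀ v ∈ e, v ∈ A) : e ∈ (restrict G A).edgeSet := by
  induction e using Sym2.ind with
  | _ a b => exact ⟨hA a (Sym2.mem_mk_left a b), hA b (Sym2.mem_mk_right a b), he⟩

theorem IsMatchingOf.union [DecidableEq V] (hM : IsMatchingOf G M)
    (hM' : IsMatchingOf (restrict G (active M)) M') : IsMatchingOf G (M ∪ M') := by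
  refine ⟨fun e he => ?_, fun e he f hf v hve hvf => ?_⟩
  · rcases Finset.mem_union.mp he with h | h
    · exact hM.1 e h
    · exact (mem_of_mem_edgeSet_restrict (hM'.1 e h)).1
  · rcases Finset.mem_union.mp he with h | h <;> rcases Finset.mem_union.mp hf with h' | h'
    · exact hM.2 e h f h' v hve hvf
    · exact absurd hve ((mem_of_mem_edgeSet_restrict (hM'.1 f h')).2 v hvf e h)
    · exact absurd hvf ((mem_of_mem_edgeSet_restrict (hM'.1 e h)).2 v hve f h')
    · exact hM'.2 e h f h' v hve hvf

open Classical in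
theorem isMatchingOf_lfmm (π : List (Sym2 V)) (H : SimpleGraph V) : IsMatchingOf H (lfmm π H) := by
  unfold lfmm
  have : ∀ M : Finset (Sym2 V), IsMatchingOf H M → IsMatchingOf H (π.foldl (fun M e =>
      if e ∈ H.edgeSet ∧ (∀ v ∈ e, v ∈ active M) then insert e M else M) M) := by
    induction π with
    | nil => exact fun M hM => hM
    | cons e π ih =>
      intro M hM
      rw [List.foldl_cons]
      refine ih _ ?_
      split_ifs with h
      · refine ⟨fun f hf => ?_, fun f hf g hg v hvf hvg => ?_⟩
        · rcases Finset.mem_insert.mp hf with rfl | hf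
          · exact h.1
          · exact hM.1 f hf
        · rcases Finset.mem_insert.mp hf with hf' | hf' <;>
            rcases Finset.mem_insert.mp hg with hg' | hg'
          · rw [hf', hg']
          · exact absurd hvg (h.2 v (hf' ▸ hvf) g hg')
          · exact absurd hvf (h.2 v (hg' ▸ hvg) f hf')
          · exact hM.2 f hf' g hg' v hvf hvg
      · exact hM
  exact this ∅ (isMatchingOf_empty H)

theorem mem_partMatching {π : List (Sym2 V)} {N : ℕ} {c : V → Fin N} {e : Sym2 V} :
    e ∈ partMatching π G M c ↔
      ∃ h, e ∈ lfmm π (restrict G {v | v ∈ active M ∧ c v = h}) := by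
  simp [partMatching]

theorem isMatchingOf_partMatching (π : List (Sym2 V)) {N : ℕ} (c : V → Fin N) :
    IsMatchingOf (restrict G (active M)) (partMatching π G M c) := by
  refine ⟨fun e he => ?_, fun e he f hf v hve hvf => ?_⟩
  · obtain ⟨h, he⟩ := mem_partMatching.mp he
    have := mem_of_mem_edgeSet_restrict ((isMatchingOf_lfmm _ _).1 e he)
    exact mem_edgeSet_restrict this.1 fun v hv => (this.2 v hv).1
  · obtain ⟨h, he⟩ := mem_partMatching.mp he
    obtain ⟨h', hf⟩ := mem_partMatching.mp hf
    have e1 := ((mem_of_mem_edgeSet_restrict ((isMatchingOf_lfmm _ _).1 e he)).2 v hve).2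
    have e2 := ((mem_of_mem_edgeSet_restrict ((isMatchingOf_lfmm _ _).1 f hf)).2 v hvf).2
    obtain rfl : h = h' := e1.symm.trans e2
    exact (isMatchingOf_lfmm _ _).2 e he f hf v hve hvf

theorem adj_of_mem_partMatching {π : List (Sym2 V)} {N : ℕ} {c : V → Fin N} {u v : V}
    (h : s(u, v) ∈ partMatching π G M c) : G.Adj u v ∧ c u = c v := by
  obtain ⟨h, he⟩ := mem_partMatching.mp h
  have := (isMatchingOf_lfmm _ _).1 _ he
  exact ⟨this.2.2, this.1.2.trans this.2.1.2.symm⟩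

open Classical in
-- A vertex of `B` lies in at most one edge of `M`, so sending each `u` to a partner in `B` is
-- injective.
theorem card_partners_le [Fintype V] (hM : IsMatchingOf G M) (B : Finset V) :
    (Finset.univ.filter fun u => ∃ v ∈ B, s(u, v) ∈ M).card ≤ B.card := by
  have h : ∀ u ∈ Finset.univ.filter fun u => ∃ v ∈ B, s(u, v) ∈ M, ∃ v ∈ B, s(u, v) ∈ M :=
    fun u hu => (Finset.mem_filter.mp hu).2
  choose! f hf hfM using h
  refine Finset.card_le_card_of_injOn f hf ?_
  intro u hu u' hu' heq
  have h1 := hfM u hu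
  have h2 := hfM u' hu'
  rw [heq] at h1
  have := hM.2 _ h1 _ h2 (f u') (Sym2.mem_mk_right _ _) (Sym2.mem_mk_right _ _)
  exact Sym2.congr_left.mp this

end Matchings

variable {k ℓ : ℕ}

/-! ## Vertices matched inside their level or upwards -/

open Classical in
/-- The vertices of level `j` that `M` matches to a vertex of the same or of a higher level. -/
noncomputable def sideMatched (j : ℕ) (M : Finset (Sym2 (HardVertex k ℓ))) :
    Finset (HardVertex k ℓ) :=
  Finset.univ.filter fun u => level u = j ∧ ∃ v, s(u, v) ∈ M ∧ j ≤ level v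

theorem sideMatched_union (j : ℕ) (M M' : Finset (Sym2 (HardVertex k ℓ))) :
    (sideMatched j (M ∪ M')).card ≤ (sideMatched j M).card + (sideMatched j M').card := by
  classical
  refine (Finset.card_le_card fun u hu => ?_).trans (Finset.card_union_le _ _)
  simp only [sideMatched, Finset.mem_union, Finset.mem_filter, Finset.mem_univ, true_and] at hu ⊢
  obtain ⟨hj, v, h | h, hv⟩ := hu
  · exact Or.inl ⟨hj, v, h, hv⟩
  · exact Or.inr ⟨hj, v, h, hv⟩

theorem card_sideMatched_le (j : ℕ) (M : Finset (Sym2 (HardVertex k ℓ))) :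
    (sideMatched j M).card ≤ 2 * M.card := by
  classical
  calc _ ≤ (M.biUnion fun e => e.toFinset).card := by
        refine Finset.card_le_card fun u hu => ?_
        simp only [sideMatched, Finset.mem_filter, Finset.mem_univ, true_and] at hu
        obtain ⟨-, v, h, -⟩ := hu
        rw [Finset.mem_biUnion]
        exact ⟨_, h, Sym2.mem_toFinset.mpr (Sym2.mem_mk_left _ _)⟩
    _ ≤ ∑ e ∈ M, e.toFinset.card := Finset.card_biUnion_le
    _ ≤ ∑ e ∈ M, 2 := Finset.sum_le_sum fun e _ => by
        rw [Sym2.card_toFinset]; split_ifs <;> omega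
    _ = _ := by rw [Finset.sum_const, smul_eq_mul, mul_comm]

open Classical in
/-- The active vertices of level `j`. -/
noncomputable def activeLevel (j : ℕ) (M : Finset (Sym2 (HardVertex k ℓ))) :
    Finset (HardVertex k ℓ) :=
  (levelSet k ℓ j).filter fun v => v ∈ active M

theorem activeInLevel_eq (j : ℕ) (M : Finset (Sym2 (HardVertex k ℓ))) :
    activeInLevel j M = (activeLevel j M).card := by
  rw [activeInLevel, ← Set.ncard_coe_finset]
  congr 1
  ext v
  simp [activeLevel, and_comm]

/-- A vertex of level `j` is active, matched downwards, or side-matched. Those matched downwards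
have distinct partners in the lower levels, which bounds their number whatever the algorithm does.
-/
theorem card_levelSet_le_active_add {G : SimpleGraph (HardVertex k ℓ)}
    {M : Finset (Sym2 (HardVertex k ℓ))} (hM : IsMatchingOf G M) (j : ℕ) :
    (levelSet k ℓ j).card ≤ (activeLevel j M).card +
      (Finset.univ.filter fun v : HardVertex k ℓ => level v < j).card +
        (sideMatched j M).card := by
  classical
  have h := card_partners_le hM (Finset.univ.filter fun v : HardVertex k ℓ => level v < j)
  refine le_trans (Finset.card_le_card ?_) ((Finset.card_union_le _ _).trans
    (Nat.add_le_add_right ((Finset.card_union_le _ _).trans (Nat.add_le_add_left h _)) _))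
  intro u hu
  rw [mem_levelSet] at hu
  simp only [activeLevel, sideMatched, Finset.mem_union, Finset.mem_filter, mem_levelSet,
    Finset.mem_univ, true_and]
  by_cases ha : u ∈ active M
  · exact Or.inl (Or.inl ⟨hu, ha⟩)
  · simp only [active, Set.mem_ofPred_eq, not_forall, not_not] at ha
    obtain ⟨e, he, hue⟩ := ha
    obtain ⟨v, rfl⟩ := Sym2.mem_iff_exists.mp hue
    rcases lt_or_ge (level v) j with hv | hv
    · exact Or.inl (Or.inr ⟨v, hv, he⟩)
    · exact Or.inr ⟨hu, v, he, hv⟩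

open Classical in
/-- The neighbours of `u` that lie in a higher level, or later in the cluster of `u`. -/
noncomputable def forwardNbrs (G : SimpleGraph (HardVertex k ℓ)) (u : HardVertex k ℓ) :
    Finset (HardVertex k ℓ) :=
  Finset.univ.filter fun v =>
    G.Adj u v ∧ (level u < level v ∨ (level u = level v ∧ place u < place v))

theorem card_forwardNbrs_le {G : SimpleGraph (HardVertex k ℓ)} (hG : IsTypical G)
    (u : HardVertex k ℓ) : (forwardNbrs G u).card ≤ 2 * clusterSize k (level u) := by
  classical
  have h1 : (Finset.univ.filter fun v => level u < level v ∧ G.Adj u v).card ≤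
      clusterSize k (level u) := by
    have := hG.upper u
    rw [← Set.ncard_coe_finset]
    simpa using this.le
  have h2 := card_clusterSet_le (k := k) (ℓ := ℓ) (level u) (clusterOf u)
  have h3 : forwardNbrs G u ⊆ (Finset.univ.filter fun v => level u < level v ∧ G.Adj u v) ∪
      clusterSet k ℓ (level u) (clusterOf u) := by
    intro v hv
    simp only [forwardNbrs, Finset.mem_filter, Finset.mem_univ, true_and] at hv
    rw [Finset.mem_union, mem_clusterSet, Finset.mem_filter]
    obtain ⟨ha, hl | hl⟩ := hv
    · exact Or.inl ⟨Finset.mem_univ _, hl, ha⟩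
    · have := hG.sameCluster u v ha hl.1
      exact Or.inr ⟨this.1.symm, this.2.symm⟩
  have h4 := (Finset.card_le_card h3).trans (Finset.card_union_le _ _)
  omega

/-- Forward edges increase (level, place) lexicographically. Encoding this pair as one number gives
the rank that the colouring bound needs. -/
theorem exists_rank_forwardNbrs (G : SimpleGraph (HardVertex k ℓ)) :
    ∃ ρ : HardVertex k ℓ → ℕ, ∀ u, ∀ v ∈ forwardNbrs G u, ρ u < ρ v := by
  obtain ⟨R, hR⟩ : ∃ R, ∀ v : HardVertex k ℓ, place v ≤ R :=
    ⟨Finset.univ.sup place, fun v => Finset.le_sup (f := place) (Finset.mem_univ v)⟩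
  refine ⟨fun v => level v * (R + 1) + place v, fun u v hv => ?_⟩
  simp only [forwardNbrs, Finset.mem_filter, Finset.mem_univ, true_and] at hv
  have hu := hR u
  obtain ⟨-, hl | ⟨hl, hp⟩⟩ := hv
  · have : (level u + 1) * (R + 1) ≤ level v * (R + 1) := Nat.mul_le_mul_right _ hl
    rw [add_mul] at this
    show level u * (R + 1) + place u < level v * (R + 1) + place v
    omega
  · show level u * (R + 1) + place u < level v * (R + 1) + place v
    rw [hl]; omega

open Classical in
/-- The vertices of level `j` that share their part with a forward neighbour. -/
noncomputable def crowded (G : SimpleGraph (HardVertex k ℓ)) (j : ℕ) {N : ℕ}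
    (c : HardVertex k ℓ → Fin N) : Finset (HardVertex k ℓ) :=
  (levelSet k ℓ j).filter fun u => ∃ v ∈ forwardNbrs G u, c u = c v

/-- For an edge going up, the lower end is crowded; for an edge inside a cluster, the end with the
smaller place is. So a side-matched vertex is crowded or the partner of a crowded one, hence the
factor 2. -/
theorem card_sideMatched_partMatching_le {G : SimpleGraph (HardVertex k ℓ)} (hG : IsTypical G)
    (π : List (Sym2 (HardVertex k ℓ))) (M : Finset (Sym2 (HardVertex k ℓ))) (j : ℕ) {N : ℕ}
    (c : HardVertex k ℓ → Fin N) :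
    (sideMatched j (partMatching π G M c)).card ≤ 2 * (crowded G j c).card := by
  classical
  have h := card_partners_le (isMatchingOf_partMatching (G := G) (M := M) π c) (crowded G j c)
  rw [two_mul]
  refine le_trans (Finset.card_le_card ?_)
    ((Finset.card_union_le _ _).trans (Nat.add_le_add_left h _))
  intro u hu
  simp only [sideMatched, Finset.mem_filter, Finset.mem_univ, true_and] at hu
  obtain ⟨hj, v, huv, hv⟩ := hu
  obtain ⟨hadj, hc⟩ := adj_of_mem_partMatching huv
  rw [Finset.mem_union]
  have mem : ∀ a b, level a = j → G.Adj a b → c a = c b →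
      (level a < level b ∨ (level a = level b ∧ place a < place b)) → a ∈ crowded G j c := by
    intro a b ha hab hcab hfw
    simp only [crowded, forwardNbrs, Finset.mem_filter, mem_levelSet, Finset.mem_univ, true_and]
    exact ⟨ha, b, ⟨hab, hfw⟩, hcab⟩
  rcases hv.lt_or_eq with hlt | heq
  · exact Or.inl (mem u v hj hadj hc (Or.inl (hj.trans_lt hlt)))
  · have hs := hG.sameCluster u v hadj (hj.trans heq)
    have hne : place u ≠ place v := fun hp => hadj.ne (hardVertex_ext hs.1 hs.2 hp)
    rcases hne.lt_or_gt with hlt | hgt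
    · exact Or.inl (mem u v hj hadj hc (Or.inr ⟨hs.1, hlt⟩))
    · refine Or.inr ?_
      simp only [Finset.mem_filter, Finset.mem_univ, true_and]
      refine ⟨v, ?_, huv⟩
      exact mem v u heq.symm hadj.symm hc.symm (Or.inr ⟨hs.1.symm, hgt⟩)

theorem uniform_crowded_ge_le {G : SimpleGraph (HardVertex k ℓ)} (hG : IsTypical G) (j N : ℕ)
    [NeZero N] (t : ℕ)
    (h : 6 * ((levelSet k ℓ j).card * ((2 * clusterSize k j : ℕ) / N : ℝ)) ≤ t) :
    (PMF.uniformOfFintype (HardVertex k ℓ → Fin N)).toOuterMeasure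
        {c | t ≤ (crowded G j c).card} ≤ ENNReal.ofReal ((1 / 2) ^ t) := by
  classical
  obtain ⟨ρ, hρ⟩ := exists_rank_forwardNbrs G
  refine le_trans ?_ ((uniform_card_bad_ge_le N (2 * clusterSize k j) (levelSet k ℓ j)
    (forwardNbrs G) ρ hρ ?_ t).trans (ENNReal.ofReal_le_ofReal
      (choose_mul_pow_le _ _ _ (by positivity) h)))
  · refine le_of_eq ?_
    congr! 5
  · intro u hu
    rw [mem_levelSet] at hu
    exact hu ▸ card_forwardNbrs_le hG u

/-! ## Degrees -/

theorem sum_ncard_neighborSet {V : Type} [Fintype V] (H : SimpleGraph V) :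
    ∑ u, (H.neighborSet u).ncard = 2 * H.edgeSet.ncard := by
  classical
  have h := H.sum_degrees_eq_twice_card_edges
  rw [← SimpleGraph.coe_edgeFinset, Set.ncard_coe_finset, ← h]
  refine Finset.sum_congr rfl fun u _ => ?_
  rw [Set.ncard_eq_toFinset_card']
  rfl

/-- Cauchy–Schwarz over the clusters: if cluster `i` has `a i` active vertices, each of them has at
least `a i - 1` active neighbours. The `+ 1` counts the vertex itself. -/
theorem sq_card_activeLevel_le {G : SimpleGraph (HardVertex k ℓ)} (hG : IsTypical G) (j : ℕ)
    (M : Finset (Sym2 (HardVertex k ℓ))) :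
    (activeLevel j M).card ^ 2 ≤ numClusters k j *
      ∑ u ∈ activeLevel j M, (((restrict G (active M)).neighborSet u).ncard + 1) := by
  classical
  have hmaps : ∀ u ∈ activeLevel j M, clusterOf u ∈ Finset.range (numClusters k j) := by
    intro u hu
    have hl : level u = j := mem_levelSet.mp (Finset.mem_filter.mp hu).1
    have := clusterOf_lt u
    rw [hl] at this
    exact Finset.mem_range.mpr this
  set a : ℕ → ℕ := fun i => ((activeLevel j M).filter fun u => clusterOf u = i).card with ha
  have h1 : (activeLevel j M).card = ∑ i ∈ Finset.range (numClusters k j), a i :=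
    Finset.card_eq_sum_card_fiberwise hmaps
  have h2 : ∑ i ∈ Finset.range (numClusters k j), a i ^ 2 =
      ∑ u ∈ activeLevel j M, a (clusterOf u) := by
    rw [← Finset.sum_fiberwise_of_maps_to hmaps]
    refine Finset.sum_congr rfl fun i _ => ?_
    rw [Finset.sum_congr rfl fun u hu => by rw [(Finset.mem_filter.mp hu).2],
      Finset.sum_const, smul_eq_mul, sq]
  have h3 : ∀ u ∈ activeLevel j M,
      a (clusterOf u) ≤ ((restrict G (active M)).neighborSet u).ncard + 1 := by
    intro u hu
    have hmem : u ∈ (activeLevel j M).filter fun v => clusterOf v = clusterOf u :=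
      Finset.mem_filter.mpr ⟨hu, rfl⟩
    show ((activeLevel j M).filter fun v => clusterOf v = clusterOf u).card ≤ _
    rw [← Finset.card_erase_add_one hmem, ← Set.ncard_coe_finset]
    refine Nat.add_le_add_right (Set.ncard_le_ncard ?_ (Set.toFinite _)) 1
    intro v hv
    rw [Finset.mem_coe, Finset.mem_erase, Finset.mem_filter] at hv
    obtain ⟨hne, hv, hc⟩ := hv
    simp only [activeLevel, Finset.mem_filter, mem_levelSet] at hu hv
    exact ⟨hu.2, hv.2, hG.adj u v hne.symm ⟨hu.1.trans hv.1.symm, hc.symm⟩⟩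
  calc (activeLevel j M).card ^ 2
      ≤ (Finset.range (numClusters k j)).card *
          ∑ i ∈ Finset.range (numClusters k j), a i ^ 2 := by
        rw [h1]; exact sq_sum_le_card_mul_sum_sq
    _ ≤ _ := by
        rw [Finset.card_range, h2]
        exact Nat.mul_le_mul_left _ (Finset.sum_le_sum h3)

/-- With `A` active vertices in the level and `m * s ≤ 2 * A`, Cauchy–Schwarz gives degree sum `D ≥
A * s / 2 - A`, which is at least `A * s / 4` as `s ≥ 4`. Then `D / A` bounds the maximum degree and
`D / n` the average degree. -/
theorem degrees_of_half_active {G : SimpleGraph (HardVertex k ℓ)} (hG : IsTypical G) {j : ℕ}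
    (hk : 0 < k) (hs : ∀ i < ℓ, clusterSize k i ^ 4 ^ i = k) (hj : j < ℓ)
    (h4 : 4 ≤ clusterSize k j) {M : Finset (Sym2 (HardVertex k ℓ))}
    (hA : 4 ^ j * k ≤ 2 * (activeLevel j M).card) :
    (clusterSize k j : ℝ) / 4 ≤ maxDeg (restrict G (active M)) ∧
      (k : ℝ) * clusterSize k j / (8 * hardN k ℓ) ≤ avgDegree G (active M) := by
  classical
  set H := restrict G (active M) with hH
  set A := (activeLevel j M).card with hAdef
  set s := clusterSize k j with hsdef
  set m := numClusters k j with hm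
  have hms : m * s = 4 ^ j * k := numClusters_mul_clusterSize (hs j hj)
  have hmspos : 0 < m * s := by rw [hms]; positivity
  have hmpos : 0 < m := Nat.pos_of_mul_pos_right hmspos
  have hApos : 0 < A := by omega
  set D := ∑ u ∈ activeLevel j M, (H.neighborSet u).ncard with hD
  have h1 : A ^ 2 ≤ m * (D + A) := by
    have := sq_card_activeLevel_le hG j M
    rwa [Finset.sum_add_distrib, Finset.sum_const, smul_eq_mul, mul_one] at this
  have h2 : (A : ℝ) * s / 4 ≤ D := by
    have e1 : (A : ℝ) ^ 2 ≤ m * (D + A) := by exact_mod_cast h1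
    have e2 : (m : ℝ) * s ≤ 2 * A := by rw [← hms] at hA; exact_mod_cast hA
    have e3 : (4 : ℝ) ≤ s := by exact_mod_cast h4
    have e4 : (0 : ℝ) < m := by exact_mod_cast hmpos
    have e5 : (0 : ℝ) < A := by exact_mod_cast hApos
    have e6 : (m : ℝ) * (A * s / 2) ≤ m * (D + A) := by nlinarith
    have e7 := le_of_mul_le_mul_left e6 e4
    nlinarith
  have h3 : D ≤ A * maxDeg H := by
    calc D ≤ ∑ u ∈ activeLevel j M, maxDeg H := Finset.sum_le_sum fun u _ =>
          Finset.le_sup (f := fun v => (H.neighborSet v).ncard) (Finset.mem_univ u)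
      _ = _ := by rw [Finset.sum_const, smul_eq_mul]
  have hA0 : (0 : ℝ) < A := by exact_mod_cast hApos
  refine ⟨?_, ?_⟩
  · have e1 : (D : ℝ) ≤ A * maxDeg H := by exact_mod_cast h3
    refine le_of_mul_le_mul_left ?_ hA0
    linarith
  · have h5 : D ≤ 2 * H.edgeSet.ncard := by
      rw [← sum_ncard_neighborSet]
      exact Finset.sum_le_sum_of_subset (Finset.subset_univ _)
    have h6 : (active M).ncard ≤ hardN k ℓ := by
      rw [← card_hardVertex hs, ← Nat.card_eq_fintype_card]
      exact Set.ncard_le_card _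
    have h7 : 0 < (active M).ncard := by
      rw [Set.ncard_pos (Set.toFinite _)]
      obtain ⟨u, hu⟩ := Finset.card_pos.mp hApos
      exact ⟨u, (Finset.mem_filter.mp hu).2⟩
    have e5 : (D : ℝ) ≤ 2 * H.edgeSet.ncard := by exact_mod_cast h5
    have e6 : ((active M).ncard : ℝ) ≤ hardN k ℓ := by exact_mod_cast h6
    have e7 : (0 : ℝ) < (active M).ncard := by exact_mod_cast h7
    have e8 : (k : ℝ) ≤ 2 * A := by
      have : k ≤ 2 * A := le_trans (Nat.le_mul_of_pos_left _ (by positivity)) hA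
      exact_mod_cast this
    unfold avgDegree
    calc (k : ℝ) * s / (8 * hardN k ℓ) ≤ (A * s / 4) / hardN k ℓ := by
          rw [div_le_div_iff₀ (by linarith) (by linarith)]
          have : (0 : ℝ) ≤ s * hardN k ℓ := by positivity
          nlinarith
      _ ≤ (A * s / 4) / (active M).ncard := by gcongr
      _ ≤ _ := by gcongr; linarith

end MMLower

namespace MMLower

/-! ## The run of the algorithm -/

/-- The failure probability `2 ^ (-2 ^ √(log n))`. -/
noncomputable def failProb (n : ℕ) : ℝ :=
  (2 : ℝ) ^ (-((2 : ℝ) ^ Real.sqrt (Real.logb 2 n)))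

/-- The inequalities between the parameters that hold for large `k`. -/
structure LargeParams (k ℓ : ℕ) : Prop where
  pos : 0 < ℓ
  size : ∀ i < ℓ, clusterSize k i ^ 4 ^ i = k
  log_large : 40 * (ℓ : ℝ) ^ 2 ≤ Real.logb 2 (hardN k ℓ) ^ 2
  four_le : ∀ i < ℓ, 4 ≤ clusterSize k i
  cleanUp : ∀ i < ℓ, 2 * ((hardN k ℓ : ℝ) / ((clusterSize k i : ℝ) / 4) ^ (0.01 : ℝ)) ≤
    k / Real.logb 2 (hardN k ℓ) ^ 2
  parts : ∀ i < ℓ, (12 * clusterSize k i * Real.logb 2 (hardN k ℓ) ^ 2) ^ 2 ≤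
    (k : ℝ) * (clusterSize k i : ℝ) ^ 4 / (8 * hardN k ℓ)
  degree : 6 * (hardN k ℓ : ℝ) ≤ k * Real.logb 2 (hardN k ℓ) ^ 2
  typical : ∀ i < ℓ, (hardN k ℓ : ℝ) * (1 / 2) ^ clusterSize k i ≤ failProb (hardN k ℓ) / 2
  crowded : (ℓ : ℝ) * (ℓ * (1 / 2) ^ ⌈(k : ℝ) / Real.logb 2 (hardN k ℓ) ^ 2⌉₊) ≤
    failProb (hardN k ℓ) / 2

/-- The state of the algorithm after `r` iterations: few vertices of the levels `j ≥ r` are matched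
inside their level or upwards. -/
structure StepInvariant {k ℓ : ℕ} (G : SimpleGraph (HardVertex k ℓ)) (r : ℕ)
    (M : Finset (Sym2 (HardVertex k ℓ))) : Prop where
  matching : IsMatchingOf G M
  side : ∀ j, r ≤ j → j < ℓ → ((sideMatched j M).card : ℝ) ≤
    r * (3 * (4 ^ j * k) / Real.logb 2 (hardN k ℓ) ^ 2)

variable {k ℓ : ℕ}

/-- The source of the gap between levels: about `√(s_r)` parts, up to polylogarithmic factors, is
still at least about `s_j ^ 2`, far above the forward degree `2 * s_j`. -/
theorem clusterSize_pow_four_le (hs : ∀ i < ℓ, clusterSize k i ^ 4 ^ i = k) (hk : 0 < k)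
    {r j : ℕ} (hrj : r < j) (hj : j < ℓ) : clusterSize k j ^ 4 ≤ clusterSize k r := by
  have h1 : (clusterSize k j ^ 4 ^ (j - r)) ^ 4 ^ r = clusterSize k r ^ 4 ^ r := by
    rw [← pow_mul, ← pow_add, Nat.sub_add_cancel hrj.le, hs j hj, hs r (hrj.trans hj)]
  have h2 : clusterSize k j ^ 4 ^ (j - r) = clusterSize k r :=
    Nat.pow_left_injective (by positivity : 4 ^ r ≠ 0) h1
  have h3 : 0 < clusterSize k j := by
    rcases Nat.eq_zero_or_pos (clusterSize k j) with h | h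
    · have := hs j hj
      rw [h, zero_pow (by positivity)] at this
      omega
    · exact h
  rw [← h2]
  refine Nat.pow_le_pow_right h3 ?_
  calc 4 = 4 ^ 1 := rfl
    _ ≤ 4 ^ (j - r) := Nat.pow_le_pow_right (by norm_num) (by omega)

/-! ### Consequences of the parameter inequalities -/

namespace LargeParams

theorem k_pos (hP : LargeParams k ℓ) : 0 < k := by
  have h := hP.four_le 0 hP.pos
  have h2 := hP.size 0 hP.pos
  rw [pow_zero, pow_one] at h2
  omega

theorem hardN_pos (hP : LargeParams k ℓ) : 0 < hardN k ℓ := by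
  unfold hardN
  refine Nat.mul_pos hP.k_pos ?_
  exact Finset.sum_pos (fun _ _ => by positivity) ⟨0, Finset.mem_range.mpr hP.pos⟩

theorem log_sq_pos (hP : LargeParams k ℓ) : 0 < Real.logb 2 (hardN k ℓ) ^ 2 := by
  refine lt_of_lt_of_le ?_ hP.log_large
  have : (0 : ℝ) < ℓ := by exact_mod_cast hP.pos
  positivity

theorem edgeProb_eq (hP : LargeParams k ℓ) {i : ℕ} (hi : i < ℓ) :
    edgeProb k ℓ i = clusterSize k i / k / Real.logb 2 (hardN k ℓ) ^ 2 := by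
  have hk : (k : ℝ) ≠ 0 := by exact_mod_cast hP.k_pos.ne'
  have h1 : (k : ℝ) ^ ((1 : ℝ) / 4 ^ i) = clusterSize k i := by
    have h2 : (k : ℝ) = (clusterSize k i : ℝ) ^ 4 ^ i := by exact_mod_cast (hP.size i hi).symm
    rw [h2, one_div]
    have := Real.pow_rpow_inv_natCast (x := (clusterSize k i : ℝ)) (n := 4 ^ i) (by positivity)
      (by positivity)
    push_cast at this
    exact this
  rw [edgeProb, Real.rpow_sub_one hk, h1]

theorem not_isTypical_le (hP : LargeParams k ℓ) :
    (hardMM k ℓ).toOuterMeasure {G | ¬ IsTypical G} ≤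
      ENNReal.ofReal (failProb (hardN k ℓ) / 2) := by
  refine hardMM_not_isTypical_le hP.size (fun i hi => ?_) hP.typical
  have hk : (0 : ℝ) < k := by exact_mod_cast hP.k_pos
  have hL := hP.log_sq_pos
  rw [hP.edgeProb_eq hi]
  have : 6 * ((hardN k ℓ : ℝ) * (clusterSize k i / k / Real.logb 2 (hardN k ℓ) ^ 2)) =
      clusterSize k i * (6 * hardN k ℓ / (k * Real.logb 2 (hardN k ℓ) ^ 2)) := by
    field_simp
  rw [this]
  -- The expected number of upper neighbours is at most `n * q_i = s_i * n / (k * log² n)`, so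
  -- `degree` makes it at most `s_i / 6`.
  refine mul_le_of_le_one_right (by positivity) ?_
  rw [div_le_one (by positivity)]
  exact hP.degree

/-- The number of active vertices in level `j ≥ r` after `r` iterations. -/
theorem card_activeLevel_ge (hP : LargeParams k ℓ) {G : SimpleGraph (HardVertex k ℓ)} {r : ℕ}
    {M : Finset (Sym2 (HardVertex k ℓ))} (h : StepInvariant G r M) {j : ℕ} (hrj : r ≤ j)
    (hj : j < ℓ) :
    ((4 : ℝ) ^ j * k * (2 / 3)) * (1 - 5 * r / Real.logb 2 (hardN k ℓ) ^ 2) ≤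
      (activeLevel j M).card := by
  have h1 := card_levelSet_le_active_add h.matching j
  rw [card_levelSet hj (hP.size j hj), card_filter_level_lt hj.le hP.size] at h1
  have h2 := three_mul_hardN_add k j
  have e1 : (4 : ℝ) ^ j * k ≤ (activeLevel j M).card + hardN k j + (sideMatched j M).card := by
    exact_mod_cast h1
  have e2 : (3 : ℝ) * hardN k j + k = 4 ^ j * k := by exact_mod_cast h2
  have e3 := h.side j hrj hj
  have hk : (0 : ℝ) < k := by exact_mod_cast hP.k_pos
  have hL := hP.log_sq_pos
  -- The subtracted term is `10 / 9` of the side-matched loss allowed by the invariant, so the bound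
  -- has slack.
  have e4 : ((4 : ℝ) ^ j * k * (2 / 3)) * (1 - 5 * r / Real.logb 2 (hardN k ℓ) ^ 2) =
      4 ^ j * k * (2 / 3) - r * (3 * (4 ^ j * k) / Real.logb 2 (hardN k ℓ) ^ 2) * (10 / 9) := by
    field_simp
    ring
  have e5 : 0 ≤ r * (3 * ((4 : ℝ) ^ j * k) / Real.logb 2 (hardN k ℓ) ^ 2) := by positivity
  rw [e4]
  linarith

theorem half_active (hP : LargeParams k ℓ) {G : SimpleGraph (HardVertex k ℓ)} {r : ℕ}
    {M : Finset (Sym2 (HardVertex k ℓ))} (h : StepInvariant G r M) (hr : r < ℓ) :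
    4 ^ r * k ≤ 2 * (activeLevel r M).card := by
  have h1 := hP.card_activeLevel_ge h le_rfl hr
  have hL := hP.log_sq_pos
  have hrl : (r : ℝ) ≤ ℓ ^ 2 := by
    have h2 : r ≤ ℓ ^ 2 := hr.le.trans (Nat.le_self_pow two_ne_zero ℓ)
    exact_mod_cast h2
  have h2 : 5 * r / Real.logb 2 (hardN k ℓ) ^ 2 ≤ 1 / 4 := by
    rw [div_le_iff₀ hL]
    linarith [hP.log_large]
  have h3 : (0 : ℝ) ≤ 4 ^ r * k := by positivity
  have h4 : (4 : ℝ) ^ r * k ≤ 2 * (activeLevel r M).card := by nlinarith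
  exact_mod_cast h4

/-- The invariant grows by three units of `4 ^ j * k / log² n`: two for the part matchings (twice
the crowded vertices) and one for the ends of the clean-up edges. -/
theorem reduceStep_not_invariant_le (hP : LargeParams k ℓ) {G : SimpleGraph (HardVertex k ℓ)} (hG : IsTypical G)
    (π : List (Sym2 (HardVertex k ℓ))) (C : CleanUp (HardVertex k ℓ)) {r : ℕ} (hr : r < ℓ)
    {M : Finset (Sym2 (HardVertex k ℓ))} (hM : StepInvariant G r M) :
    (reduceStep π C G r M).toOuterMeasure {M' | ¬ StepInvariant G (r + 1) M'} ≤
      ENNReal.ofReal (ℓ * (1 / 2) ^ ⌈(k : ℝ) / Real.logb 2 (hardN k ℓ) ^ 2⌉₊) := by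
  set L2 := Real.logb 2 (hardN k ℓ) ^ 2 with hL2
  have hL : 0 < L2 := hP.log_sq_pos
  have hk : (0 : ℝ) < k := by exact_mod_cast hP.k_pos
  have hn : (0 : ℝ) < hardN k ℓ := by exact_mod_cast hP.hardN_pos
  obtain ⟨hdeg, havg⟩ := degrees_of_half_active hG hP.k_pos hP.size hr (hP.four_le r hr)
    (hP.half_active hM hr)
  set N := numParts G M with hN
  -- The constant 12 makes the tail bound apply: six times the mean `4 ^ j * k * (2 * s_j / N)` must
  -- not exceed `4 ^ j * k / log² n`.
  have hparts : ∀ j, r < j → j < ℓ → 12 * (clusterSize k j : ℝ) * L2 ≤ N := by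
    intro j hrj hj
    have h1 : (12 * (clusterSize k j : ℝ) * L2) ^ 2 ≤ avgDegree G (active M) := by
      refine (hP.parts j hj).trans (le_trans ?_ havg)
      have : (clusterSize k j : ℝ) ^ 4 ≤ clusterSize k r := by
        exact_mod_cast clusterSize_pow_four_le hP.size hP.k_pos hrj hj
      gcongr
    have h2 := Real.le_sqrt_of_sq_le h1
    refine h2.trans ((Nat.le_ceil _).trans ?_)
    exact_mod_cast le_max_right _ _
  set t : ℕ → ℕ := fun j => ⌈(4 : ℝ) ^ j * k / L2⌉₊ with ht
  set B : Set (HardVertex k ℓ → Fin N) :=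
    ⋃ j ∈ Finset.Ioo r ℓ, {c | t j ≤ (MMLower.crowded G j c).card} with hB
  have hBle : (PMF.uniformOfFintype (HardVertex k ℓ → Fin N)).toOuterMeasure B ≤
      ENNReal.ofReal (ℓ * (1 / 2) ^ ⌈(k : ℝ) / L2⌉₊) := by
    calc _ ≤ ∑ j ∈ Finset.Ioo r ℓ, (PMF.uniformOfFintype (HardVertex k ℓ → Fin N)).toOuterMeasure
            {c | t j ≤ (MMLower.crowded G j c).card} := MeasureTheory.measure_biUnion_finset_le _ _
      _ ≤ ∑ j ∈ Finset.Ioo r ℓ, ENNReal.ofReal ((1 / 2) ^ ⌈(k : ℝ) / L2⌉₊) := by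
          refine Finset.sum_le_sum fun j hj => ?_
          obtain ⟨hrj, hj⟩ := Finset.mem_Ioo.mp hj
          refine (uniform_crowded_ge_le hG j N (t j) ?_).trans (ENNReal.ofReal_le_ofReal ?_)
          · rw [card_levelSet hj (hP.size j hj)]
            refine le_trans ?_ (Nat.le_ceil _)
            have hp := hparts j hrj hj
            have hs : (0 : ℝ) < clusterSize k j := by
              have := hP.four_le j hj
              exact_mod_cast (by omega : 0 < clusterSize k j)
            have hN0 : (0 : ℝ) < N := lt_of_lt_of_le (by positivity) hp
            push_cast
            rw [mul_div_assoc', mul_div_assoc', div_le_div_iff₀ hN0 hL]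
            have : (0 : ℝ) ≤ 4 ^ j * k := by positivity
            nlinarith
          · refine pow_le_pow_of_le_one (by norm_num) (by norm_num) ?_
            refine Nat.ceil_le_ceil ?_
            gcongr
            exact le_mul_of_one_le_left hk.le (one_le_pow₀ (by norm_num))
      _ ≤ ∑ j ∈ Finset.range ℓ, ENNReal.ofReal ((1 / 2) ^ ⌈(k : ℝ) / L2⌉₊) := by
          refine Finset.sum_le_sum_of_subset fun j hj => ?_
          exact Finset.mem_range.mpr (Finset.mem_Ioo.mp hj).2
      _ = _ := by
          rw [Finset.sum_const, Finset.card_range, nsmul_eq_mul,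
            ENNReal.ofReal_mul (by positivity), ENNReal.ofReal_natCast]
  unfold reduceStep
  -- Off `B` the step succeeds for every admissible clean-up, so its randomness adds no failure
  -- probability.
  refine (toOuterMeasure_bind_le _ _ _ B 0 ?_).trans (by rw [add_zero]; exact hBle)
  intro c _ hc
  rw [PMF.toOuterMeasure_map_apply, nonpos_iff_eq_zero, PMF.toOuterMeasure_apply_eq_zero_iff,
    Set.disjoint_left]
  intro X hX hbad
  refine hbad ⟨?_, fun j hrj hj => ?_⟩
  · have hX' := C.isMatching G r M _ X hX
    exact (hM.matching.union (isMatchingOf_partMatching π c)).union hX'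
  · have hXc := C.card_le G r M _ X hX
    rw [card_hardVertex hP.size] at hXc
    have h1 : (X.card : ℝ) ≤ hardN k ℓ / ((clusterSize k r : ℝ) / 4) ^ (0.01 : ℝ) := by
      refine hXc.trans ?_
      have h0 : (0 : ℝ) < (clusterSize k r : ℝ) / 4 := by
        have := hP.four_le r hr
        have : (0 : ℝ) < clusterSize k r := by exact_mod_cast (by omega : 0 < clusterSize k r)
        positivity
      gcongr
    have h2 : 2 * (X.card : ℝ) ≤ 4 ^ j * k / L2 := by
      calc 2 * (X.card : ℝ) ≤ k / L2 := by linarith [hP.cleanUp r hr]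
        _ ≤ _ := by
          gcongr
          exact le_mul_of_one_le_left hk.le (one_le_pow₀ (by norm_num))
    have h3 : ((MMLower.crowded G j c).card : ℝ) ≤ 4 ^ j * k / L2 := by
      have : ¬ t j ≤ (MMLower.crowded G j c).card := by
        intro hcon
        refine hc ?_
        simp only [hB, Set.mem_iUnion]
        exact ⟨j, Finset.mem_Ioo.mpr ⟨hrj, hj⟩, hcon⟩
      exact (Nat.lt_ceil.mp (not_le.mp this)).le
    have h4 : (sideMatched j (M ∪ partMatching π G M c ∪ X)).card ≤
        (sideMatched j M).card + 2 * (MMLower.crowded G j c).card + 2 * X.card := by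
      have a1 := sideMatched_union j (M ∪ partMatching π G M c) X
      have a2 := sideMatched_union j M (partMatching π G M c)
      have a3 := card_sideMatched_partMatching_le hG π M j c
      have a4 := card_sideMatched_le j X
      omega
    have h5 : ((sideMatched j (M ∪ partMatching π G M c ∪ X)).card : ℝ) ≤
        (sideMatched j M).card + 2 * (MMLower.crowded G j c).card + 2 * X.card := by
      exact_mod_cast h4
    have h6 := hM.side j (by omega) hj
    have h7 : 3 * (4 ^ j * (k : ℝ)) / L2 = 3 * (4 ^ j * k / L2) := by ring
    rw [← hL2] at h6 ⊢
    rw [h7] at h6 ⊢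
    push_cast
    linarith

theorem reduceMM_not_invariant_le (hP : LargeParams k ℓ) {G : SimpleGraph (HardVertex k ℓ)} (hG : IsTypical G)
    (π : List (Sym2 (HardVertex k ℓ))) (C : CleanUp (HardVertex k ℓ)) (r : ℕ) (hr : r ≤ ℓ) :
    (reduceMM π C G r).toOuterMeasure {M | ¬ StepInvariant G r M} ≤
      r * ENNReal.ofReal (ℓ * (1 / 2) ^ ⌈(k : ℝ) / Real.logb 2 (hardN k ℓ) ^ 2⌉₊) := by
  induction r with
  | zero =>
    simp only [reduceMM, Nat.cast_zero, zero_mul, nonpos_iff_eq_zero,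
      PMF.toOuterMeasure_apply_eq_zero_iff, PMF.support_pure, Set.disjoint_singleton_left,
      Set.mem_ofPred_eq, not_not]
    exact ⟨isMatchingOf_empty G, fun j _ _ => by simp [sideMatched]⟩
  | succ r ih =>
    rw [reduceMM]
    refine (toOuterMeasure_bind_le _ _ _ {M | ¬ StepInvariant G r M}
      (ENNReal.ofReal (ℓ * (1 / 2) ^ ⌈(k : ℝ) / Real.logb 2 (hardN k ℓ) ^ 2⌉₊)) ?_).trans ?_
    · intro M _ hM
      exact hP.reduceStep_not_invariant_le hG π C hr (not_not.mp hM)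
    · rw [Nat.cast_succ, add_mul, one_mul]
      gcongr
      exact ih (by omega)

/-- Every event implied by the state of the algorithm on a typical graph has high probability. -/
theorem highProb_le_prob (hP : LargeParams k ℓ) (π : List (Sym2 (HardVertex k ℓ))) (C : CleanUp (HardVertex k ℓ))
    {r : ℕ} (hr : r ≤ ℓ)
    (E : Set (SimpleGraph (HardVertex k ℓ) × Finset (Sym2 (HardVertex k ℓ))))
    (hE : ∀ G M, IsTypical G → StepInvariant G r M → (G, M) ∈ E) :
    highProb (hardN k ℓ) ≤ prob (hardRun k ℓ π C r) E := by
  have hη : 0 ≤ failProb (hardN k ℓ) := by unfold failProb; positivity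
  refine one_sub_le_prob _ _ hη ?_
  unfold hardRun
  refine (toOuterMeasure_bind_le _ _ _ {G | ¬ IsTypical G}
    (ENNReal.ofReal (failProb (hardN k ℓ) / 2)) ?_).trans ?_
  · intro G _ hG
    rw [PMF.toOuterMeasure_map_apply]
    have hG' : IsTypical G := not_not.mp hG
    calc _ ≤ (reduceMM π C G r).toOuterMeasure {M | ¬ StepInvariant G r M} := by
          refine MeasureTheory.measure_mono fun M hM hinv => ?_
          exact hM (hE G M hG' hinv)
      _ ≤ _ := hP.reduceMM_not_invariant_le hG' π C r hr
      _ = ENNReal.ofReal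
          (r * (ℓ * (1 / 2) ^ ⌈(k : ℝ) / Real.logb 2 (hardN k ℓ) ^ 2⌉₊)) := by
          rw [ENNReal.ofReal_mul (Nat.cast_nonneg r), ENNReal.ofReal_natCast]
      _ ≤ _ := by
          refine ENNReal.ofReal_le_ofReal (le_trans ?_ hP.crowded)
          have : (r : ℝ) ≤ ℓ := by exact_mod_cast hr
          gcongr
  · calc _ ≤ ENNReal.ofReal (failProb (hardN k ℓ) / 2) +
          ENNReal.ofReal (failProb (hardN k ℓ) / 2) := by
          gcongr; exact hP.not_isTypical_le
      _ = _ := by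
          rw [← ENNReal.ofReal_add (by positivity) (by positivity), add_halves]
          rfl

/-- Pigeonhole: half of level `r` is active and clusters have at least four vertices, so there are
more active vertices than clusters. Two of them in one cluster give an edge that extends the
matching. -/
theorem not_isMaximal (hP : LargeParams k ℓ) {G : SimpleGraph (HardVertex k ℓ)} (hG : IsTypical G) {r : ℕ}
    (hr : r < ℓ) {M : Finset (Sym2 (HardVertex k ℓ))} (h : StepInvariant G r M) :
    ¬ IsMaximalMatchingOf G M := by
  classical
  intro hmax
  have h1 := hP.half_active h hr
  have h4 := hP.four_le r hr
  have hms := numClusters_mul_clusterSize (hP.size r hr)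
  have hpos : 0 < 4 ^ r * k := Nat.mul_pos (by positivity) hP.k_pos
  have hlt : (Finset.range (numClusters k r)).card < (activeLevel r M).card := by
    rw [Finset.card_range]
    rw [← hms] at h1 hpos
    have : 0 < numClusters k r := Nat.pos_of_mul_pos_right hpos
    nlinarith
  obtain ⟨u, hu, v, hv, huv, hc⟩ := Finset.exists_ne_map_eq_of_card_lt_of_maps_to hlt
    (f := clusterOf) (fun u hu => by
      have hl : level u = r := mem_levelSet.mp (Finset.mem_filter.mp hu).1
      have := clusterOf_lt u
      rw [hl] at this
      simpa using this)
  simp only [activeLevel, Finset.mem_filter, mem_levelSet] at hu hv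
  have hadj : G.Adj u v := hG.adj u v huv ⟨hu.1.trans hv.1.symm, hc⟩
  have hnew : IsMatchingOf (restrict G (active M)) {s(u, v)} := by
    refine ⟨fun e he => ?_, fun e he f hf _ _ _ => ?_⟩
    · rw [Finset.mem_singleton] at he
      subst he
      exact ⟨hu.2, hv.2, hadj⟩
    · rw [Finset.mem_singleton] at he hf
      rw [he, hf]
  have hle := hmax.2 (h.matching.union hnew) Finset.subset_union_left
  exact hu.2 _ (hle (Finset.mem_union_right _ (Finset.mem_singleton_self _)))
    (Sym2.mem_mk_left u v)

end LargeParams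

end MMLower

namespace MMLower

/-! ## Large parameters -/

/-- Powers are negligible against exponentials in the variable `x ^ 0.9`. -/
theorem eventually_rpow_le_two_rpow (a : ℝ) {b : ℝ} (hb : 0 < b) :
    ∀ᶠ x : ℝ in Filter.atTop, x ^ a ≤ 2 ^ (b * x ^ (0.9 : ℝ)) := by
  have hlog : 0 < Real.log 2 := Real.log_pos (by norm_num)
  have h1 := (isLittleO_rpow_exp_pos_mul_atTop (a / 0.9) (mul_pos hlog hb)).comp_tendsto
    (tendsto_rpow_atTop (by norm_num : (0 : ℝ) < 0.9))
  filter_upwards [h1.bound one_pos, Filter.eventually_ge_atTop 0] with x hx hx0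
  simp only [Function.comp_apply, one_mul, Real.norm_eq_abs, Real.abs_exp] at hx
  rw [← Real.rpow_mul hx0] at hx
  have h2 : (0.9 : ℝ) * (a / 0.9) = a := by ring
  rw [h2, mul_assoc] at hx
  rw [Real.rpow_def_of_pos (by norm_num : (0 : ℝ) < 2)]
  exact (le_abs_self _).trans hx

/-- The bounds on `x = log k = z ^ 10` that are used. -/
theorem exists_large_bounds : ∃ X : ℝ, ∀ x : ℝ, X ≤ x → ∃ z : ℝ, 16 ≤ z ∧ x = z ^ 10 ∧
    z = x ^ (0.1 : ℝ) ∧ x ^ 3 ≤ ((2 : ℝ) ^ z ^ 9 / 4) ^ (0.01 : ℝ) ∧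
    200 * x ^ 5 ≤ (2 : ℝ) ^ z ^ 9 ∧ 2 * x + 1 + 2 ^ Real.sqrt (2 * x) ≤ (2 : ℝ) ^ z ^ 9 := by
  -- Half of the exponent `0.01` absorbs the division by 4, as `z ^ 9 - 2 ≥ z ^ 9 / 2`. The power 6
  -- leaves a spare factor `x` for the numerical constants.
  obtain ⟨X, hX⟩ := Filter.eventually_atTop.mp ((eventually_rpow_le_two_rpow 3
    (by norm_num : (0 : ℝ) < 0.005)).and (eventually_rpow_le_two_rpow 6 one_pos))
  refine ⟨max X (2 ^ 40), fun x hx => ⟨x ^ (0.1 : ℝ), ?_⟩⟩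
  have hx40 : (2 : ℝ) ^ 40 ≤ x := (le_max_right _ _).trans hx
  have hx0 : 0 ≤ x := le_trans (by positivity) hx40
  have hz : 16 ≤ x ^ (0.1 : ℝ) := by
    calc (16 : ℝ) = (2 ^ 40 : ℝ) ^ (0.1 : ℝ) := by
          rw [← Real.rpow_natCast, ← Real.rpow_mul (by norm_num)]
          norm_num
      _ ≤ _ := by gcongr
  have hpow : ∀ m : ℕ, (x ^ (0.1 : ℝ)) ^ m = x ^ (0.1 * m : ℝ) := fun m => by
    rw [← Real.rpow_natCast, ← Real.rpow_mul hx0]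
  have h10 : x = (x ^ (0.1 : ℝ)) ^ 10 := by
    rw [hpow]; norm_num
  have h9 : x ^ (0.9 : ℝ) = (x ^ (0.1 : ℝ)) ^ 9 := by
    rw [hpow]; norm_num
  obtain ⟨h1, h2⟩ := hX x ((le_max_left _ _).trans hx)
  rw [h9] at h1 h2
  rw [one_mul] at h2
  set z := x ^ (0.1 : ℝ) with hzdef
  have e3 : x ^ (3 : ℝ) = x ^ 3 := by exact_mod_cast Real.rpow_natCast x 3
  have e6 : x ^ (6 : ℝ) = x ^ 6 := by exact_mod_cast Real.rpow_natCast x 6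
  rw [e3] at h1
  rw [e6] at h2
  have hx1 : (1000 : ℝ) ≤ x := le_trans (by norm_num) hx40
  have hz9 : (4 : ℝ) ≤ z ^ 9 := by
    calc (4 : ℝ) ≤ 16 ^ 9 := by norm_num
      _ ≤ z ^ 9 := by gcongr
  have h5 : (1 : ℝ) ≤ x ^ 5 := one_le_pow₀ (by linarith)
  have h65 : x ^ 6 = x * x ^ 5 := by ring
  refine ⟨hz, h10, rfl, h1.trans ?_, ?_, ?_⟩
  · have : (2 : ℝ) ^ z ^ 9 / 4 = 2 ^ (z ^ 9 - 2) := by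
      rw [Real.rpow_sub (by norm_num)]
      norm_num
    rw [this, ← Real.rpow_mul (by norm_num)]
    refine Real.rpow_le_rpow_of_exponent_le (by norm_num) ?_
    linarith
  · refine le_trans ?_ h2
    rw [h65]
    nlinarith
  · have a1 : 2 * x + 1 ≤ (2 : ℝ) ^ z ^ 9 / 2 := by
      have b1 : x ≤ x ^ 5 := le_self_pow₀ (by linarith) (by norm_num)
      have b2 : 1000 * x ^ 5 ≤ x ^ 6 := by rw [h65]; gcongr
      linarith
    have a2 : (2 : ℝ) ^ Real.sqrt (2 * x) ≤ (2 : ℝ) ^ z ^ 9 / 2 := by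
      have b0 : (2 : ℝ) ^ z ^ 9 / 2 = 2 ^ (z ^ 9 - 1) := by
        rw [Real.rpow_sub (by norm_num), Real.rpow_one]
      rw [b0]
      refine Real.rpow_le_rpow_of_exponent_le (by norm_num) ?_
      have b1 : Real.sqrt (2 * x) ≤ 2 * z ^ 5 := by
        refine Real.sqrt_le_iff.mpr ⟨by positivity, ?_⟩
        rw [h10]
        have : (0 : ℝ) ≤ z ^ 10 := by positivity
        nlinarith
      have b2 : z ^ 9 = z ^ 5 * z ^ 4 := by ring
      have b3 : (3 : ℝ) ≤ z ^ 4 := le_trans (by norm_num) (pow_le_pow_left₀ (by norm_num) hz 4)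
      have b4 : (1 : ℝ) ≤ z ^ 5 := one_le_pow₀ (by linarith)
      nlinarith
    linarith

/-- The divisor 20 in the choice of `ℓ` is what keeps `4 ^ ℓ` below `(log k) ^ 0.1`, so that `n / k`
is tiny and every cluster is huge. -/
theorem four_pow_floor_le {x : ℝ} (hx : 1 ≤ x) :
    (4 : ℝ) ^ ⌊Real.logb 2 x / 20⌋₊ ≤ x ^ (0.1 : ℝ) := by
  have hlog : 0 ≤ Real.logb 2 x := Real.logb_nonneg (by norm_num) hx
  calc (4 : ℝ) ^ ⌊Real.logb 2 x / 20⌋₊ = 2 ^ (2 * (⌊Real.logb 2 x / 20⌋₊ : ℝ)) := by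
        rw [Real.rpow_mul (by norm_num), Real.rpow_natCast]; norm_num
    _ ≤ 2 ^ (Real.logb 2 x * 0.1) := by
        refine Real.rpow_le_rpow_of_exponent_le (by norm_num) ?_
        have := Nat.floor_le (div_nonneg hlog (by norm_num : (0 : ℝ) ≤ 20))
        linarith
    _ = x ^ (0.1 : ℝ) := by
        rw [Real.rpow_mul (by norm_num), Real.rpow_logb (by norm_num) (by norm_num) (by linarith)]

theorem two_rpow_le_clusterSize {k i : ℕ} {w : ℝ} (hk : 0 < k)
    (hs : clusterSize k i ^ 4 ^ i = k) (hw : w * 4 ^ i ≤ Real.logb 2 k) :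
    (2 : ℝ) ^ w ≤ clusterSize k i := by
  have h0 : 0 < clusterSize k i := by
    rcases Nat.eq_zero_or_pos (clusterSize k i) with h | h
    · rw [h, zero_pow (by positivity)] at hs
      omega
    · exact h
  have h1 : Real.logb 2 k = 4 ^ i * Real.logb 2 (clusterSize k i) := by
    conv_lhs => rw [← hs]
    rw [Nat.cast_pow, Real.logb_pow]
    norm_num
  rw [h1, mul_comm] at hw
  rw [← Real.le_logb_iff_rpow_le (by norm_num) (by exact_mod_cast h0)]
  exact le_of_mul_le_mul_left hw (by positivity)

theorem mul_half_pow_le_failProb {n T : ℕ} (hn : 0 < n)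
    (h : Real.logb 2 n + 1 + 2 ^ Real.sqrt (Real.logb 2 n) ≤ (T : ℝ)) :
    (n : ℝ) * (1 / 2) ^ T ≤ failProb n / 2 := by
  have h1 : (n : ℝ) * (1 / 2) ^ T = 2 ^ (Real.logb 2 n - T) := by
    rw [Real.rpow_sub (by norm_num), Real.rpow_logb (by norm_num) (by norm_num)
      (by exact_mod_cast hn), Real.rpow_natCast, one_div, inv_pow, div_eq_mul_inv]
  have h2 : failProb n / 2 = 2 ^ (-((2 : ℝ) ^ Real.sqrt (Real.logb 2 n)) - 1) := by
    rw [Real.rpow_sub (by norm_num), Real.rpow_one]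
    rfl
  rw [h1, h2]
  refine Real.rpow_le_rpow_of_exponent_le (by norm_num) ?_
  linarith

/-- For large `k` the parameters satisfy all inequalities that are needed, and `c log (log n)` is
at most half of the number of levels. -/
theorem exists_largeParams : ∃ k₀ : ℕ, ∀ k ℓ : ℕ, k₀ ≤ k →
    ℓ = ⌊Real.logb 2 (Real.logb 2 k) / 20⌋₊ → (∀ i < ℓ, clusterSize k i ^ 4 ^ i = k) →
    LargeParams k ℓ ∧ 2 * (1 / 100 * Real.logb 2 (Real.logb 2 (hardN k ℓ))) ≤ ℓ := by
  obtain ⟨X, hX⟩ := exists_large_bounds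
  refine ⟨⌈(2 : ℝ) ^ X⌉₊ + 1, fun k ℓ hk hℓ hs => ?_⟩
  have hk0 : 0 < k := by omega
  have hkR : (0 : ℝ) < k := by exact_mod_cast hk0
  have hXk : X ≤ Real.logb 2 k := by
    rw [Real.le_logb_iff_rpow_le (by norm_num) hkR]
    refine (Nat.le_ceil _).trans ?_
    exact_mod_cast (by omega : ⌈(2 : ℝ) ^ X⌉₊ ≤ k)
  obtain ⟨z, hz, hxz, hzx, b1, b2, b3⟩ := hX _ hXk
  set x := Real.logb 2 k with hx
  -- A common lower bound for all cluster sizes: `log s_i = x / 4 ^ i ≥ z ^ 10 / z`. It beats every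
  -- fixed power of `x`, while `n / k ≤ z` and `x ≤ log n ≤ 2 * x`.
  set S := (2 : ℝ) ^ z ^ 9 with hS
  have hz0 : 0 < z := by linarith
  have hxbig : (2 : ℝ) ^ 40 ≤ x := by
    rw [hxz]
    calc (2 : ℝ) ^ 40 = 16 ^ 10 := by norm_num
      _ ≤ _ := by gcongr
  have hx0 : 0 < x := lt_of_lt_of_le (by norm_num) hxbig
  have hx1 : 1 ≤ x := le_trans (by norm_num) hxbig
  have hzx9 : 16 ^ 9 * z ≤ x := by
    rw [hxz, pow_succ z 9]
    gcongr
  have hy : 40 ≤ Real.logb 2 x := by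
    rw [Real.le_logb_iff_rpow_le (by norm_num) hx0]
    exact_mod_cast hxbig
  have hℓpos : 0 < ℓ := by
    rw [hℓ, Nat.floor_pos]
    linarith
  have hE : (4 : ℝ) ^ ℓ ≤ z := by
    rw [hℓ, hzx]; exact four_pow_floor_le hx1
  have hℓz : (ℓ : ℝ) ≤ z := by
    refine le_trans ?_ hE
    have : ℓ ≤ 4 ^ ℓ := (Nat.lt_pow_self (by norm_num)).le
    exact_mod_cast this
  have hSs : ∀ i < ℓ, S ≤ clusterSize k i := by
    intro i hi
    refine two_rpow_le_clusterSize hk0 (hs i hi) ?_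
    have : (4 : ℝ) ^ i ≤ z := le_trans (pow_le_pow_right₀ (by norm_num) hi.le) hE
    calc z ^ 9 * 4 ^ i ≤ z ^ 9 * z := by gcongr
      _ = z ^ 10 := by ring
      _ = Real.logb 2 k := hxz.symm
  have hx5 : x ≤ x ^ 5 := le_self_pow₀ hx1 (by norm_num)
  have hxS : 200 * x ≤ S := by linarith
  have hS0 : 0 < S := by linarith
  have hSk : S ^ 2 ≤ k := by
    have hkx : (k : ℝ) = 2 ^ x := by
      rw [hx, Real.rpow_logb (by norm_num) (by norm_num) hkR]
    rw [hkx, hS, ← Real.rpow_natCast, ← Real.rpow_mul (by norm_num)]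
    refine Real.rpow_le_rpow_of_exponent_le (by norm_num) ?_
    rw [hxz, pow_succ z 9]
    push_cast
    gcongr
    linarith
  have hSk1 : S ≤ k := le_trans (le_self_pow₀ (by linarith) (by norm_num)) hSk
  set n := hardN k ℓ with hn
  have h3n : (3 : ℝ) * n + k = 4 ^ ℓ * k := by exact_mod_cast three_mul_hardN_add k ℓ
  have hnz : (n : ℝ) ≤ z * k := by
    have : (4 : ℝ) ^ ℓ * k ≤ z * k := by gcongr
    linarith [Nat.cast_nonneg (α := ℝ) n]
  have hkn : (k : ℝ) ≤ n := by
    have : (4 : ℝ) ≤ 4 ^ ℓ := le_self_pow₀ (by norm_num) hℓpos.ne'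
    have : (4 : ℝ) * k ≤ 4 ^ ℓ * k := by gcongr
    linarith
  have hn0 : (0 : ℝ) < n := lt_of_lt_of_le hkR hkn
  set L := Real.logb 2 n with hL
  have hxL : x ≤ L := Real.logb_le_logb_of_le (by norm_num) hkR hkn
  have hzk : z ≤ k := by linarith
  have hL2x : L ≤ 2 * x := by
    have h1 : (n : ℝ) ≤ (k : ℝ) ^ 2 := by
      rw [sq]; exact hnz.trans (by gcongr)
    have h2 := Real.logb_le_logb_of_le (by norm_num : (1 : ℝ) < 2) hn0 h1
    rw [Real.logb_pow] at h2
    exact_mod_cast h2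
  have hL0 : 0 < L := by linarith
  have hLsq : x ^ 2 ≤ L ^ 2 := by gcongr
  have hLsq' : L ^ 2 ≤ 4 * x ^ 2 := by nlinarith
  have hxx : x ≤ x ^ 2 := le_self_pow₀ hx1 (by norm_num)
  have hfail : ∀ T : ℕ, S ≤ T → (n : ℝ) * (1 / 2) ^ T ≤ failProb n / 2 := by
    intro T hT
    refine mul_half_pow_le_failProb (by exact_mod_cast hn0) (le_trans ?_ (b3.trans hT))
    have : (2 : ℝ) ^ Real.sqrt L ≤ 2 ^ Real.sqrt (2 * x) :=
      Real.rpow_le_rpow_of_exponent_le (by norm_num) (Real.sqrt_le_sqrt hL2x)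
    linarith
  have hzz : z ^ 2 ≤ x := by
    rw [hxz]
    exact pow_le_pow_right₀ (by linarith) (by norm_num)
  have hℓ2 : (ℓ : ℝ) ^ 2 ≤ x := le_trans (by gcongr) hzz
  refine ⟨⟨hℓpos, hs, ?_, ?_, ?_, ?_, ?_, ?_, ?_⟩, ?_⟩
  · nlinarith
  · intro i hi
    have : (4 : ℝ) ≤ clusterSize k i := by linarith [hSs i hi]
    exact_mod_cast this
  · intro i hi
    have h1 : x ^ 3 ≤ ((clusterSize k i : ℝ) / 4) ^ (0.01 : ℝ) := by
      refine b1.trans ?_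
      have := hSs i hi
      gcongr
    calc 2 * ((n : ℝ) / ((clusterSize k i : ℝ) / 4) ^ (0.01 : ℝ)) ≤ 2 * (z * k / x ^ 3) := by
          gcongr
      _ ≤ k / (4 * x ^ 2) := by
          rw [mul_div_assoc', div_le_div_iff₀ (by positivity) (by positivity)]
          have : k * x ^ 2 * (8 * z) ≤ k * x ^ 2 * x := by
            gcongr
            linarith
          linarith
      _ ≤ _ := by gcongr
  · intro i hi
    have hsi := hSs i hi
    set s : ℝ := (clusterSize k i : ℝ)
    have hs0 : 0 < s := by linarith
    have h1 : 20000 * x ^ 5 ≤ s ^ 2 := by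
      calc 20000 * x ^ 5 = 100 * (200 * x ^ 5) := by ring
        _ ≤ s * s := by
          gcongr
          · linarith
          · linarith
        _ = s ^ 2 := by ring
    calc (12 * s * L ^ 2) ^ 2 ≤ (12 * s * (4 * x ^ 2)) ^ 2 := by gcongr
      _ = s ^ 2 * (2304 * x ^ 4) := by ring
      _ ≤ s ^ 4 / (8 * z) := by
          rw [le_div_iff₀ (by positivity)]
          have h2 : x ^ 4 * (18432 * z) ≤ x ^ 4 * (20000 * x) := by
            gcongr
            · norm_num
            · linarith
          have h3 : s ^ 2 * (2304 * x ^ 4 * (8 * z)) ≤ s ^ 2 * s ^ 2 := by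
            gcongr
            linarith
          linarith
      _ = k * s ^ 4 / (8 * (z * k)) := by field_simp
      _ ≤ _ := by gcongr
  · have : 6 * z ≤ L ^ 2 := by linarith
    have h2 : k * (6 * z) ≤ k * L ^ 2 := by gcongr
    linarith
  · exact fun i hi => hfail _ (hSs i hi)
  · have h1 : S ≤ ((⌈(k : ℝ) / L ^ 2⌉₊ : ℕ) : ℝ) := by
      refine le_trans ?_ (Nat.le_ceil _)
      rw [le_div_iff₀ (by positivity)]
      have h25 : x ^ 2 ≤ x ^ 5 := pow_le_pow_right₀ hx1 (by norm_num)
      calc S * L ^ 2 ≤ S * S := by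
            gcongr
            linarith
        _ ≤ k := by rw [← sq]; exact hSk
    -- Since `ℓ ^ 2 ≤ n`, the union bound over iterations and levels is covered by the estimate
    -- already used for the vertices.
    refine le_trans ?_ (hfail _ h1)
    rw [← mul_assoc, ← sq]
    gcongr
    linarith
  · have h1 : Real.logb 2 L ≤ 1 + Real.logb 2 x := by
      have h2 := Real.logb_le_logb_of_le (by norm_num : (1 : ℝ) < 2) hL0 hL2x
      rwa [Real.logb_mul (by norm_num) hx0.ne', Real.logb_self_eq_one (by norm_num)] at h2
    have h2 := Nat.lt_floor_add_one (Real.logb 2 x / 20)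
    rw [← hℓ] at h2
    linarith

end MMLower

/-! ### The main theorem -/

theorem mainTheorem6 :
    ∃ c : ℝ, 0 < c ∧ ∃ k₀ : ℕ, ∀ k ℓ : ℕ, k₀ ≤ k →
      ℓ = ⌊Real.logb 2 (Real.logb 2 k) / 20⌋₊ →
      (∀ i < ℓ, ∃ s : ℕ, Even s ∧ s ^ (4 ^ i) = k) →
      -- every graph of the distribution has a perfect matching
      (∀ G ∈ (MMLower.hardMM k ℓ).support, ∃ P : G.Subgraph, P.IsPerfectMatching) ∧
      ∀ π : List (Sym2 (MMLower.HardVertex k ℓ)), (∀ e, e ∈ π) →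
      ∀ C : MMLower.CleanUp (MMLower.HardVertex k ℓ),
        -- more than `c * log (log n)` iterations are needed
        (∀ r : ℕ, (r : ℝ) ≤ c * Real.logb 2 (Real.logb 2 (MMLower.hardN k ℓ)) →
          MMLower.highProb (MMLower.hardN k ℓ) ≤
            MMLower.prob (MMLower.hardRun k ℓ π C r)
              {x | ¬ MMLower.IsMaximalMatchingOf x.1 x.2}) ∧
        -- about two thirds of each level `j ≥ r` are active after `r ≤ ℓ / 2` iterations
        (∀ r j : ℕ, 2 * r ≤ ℓ → r ≤ j → j < ℓ →
          MMLower.highProb (MMLower.hardN k ℓ) ≤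
            MMLower.prob (MMLower.hardRun k ℓ π C r)
              {x | ((4 : ℝ) ^ j * k * (2 / 3)) *
                  (1 - 10 * ℓ * r / Real.logb 2 (MMLower.hardN k ℓ) ^ 2) ≤
                (MMLower.activeInLevel j x.2 : ℝ)}) := by
  classical
  obtain ⟨k₀, hk₀⟩ := MMLower.exists_largeParams
  refine ⟨1 / 100, by norm_num, k₀, fun k ℓ hk hℓ hs => ?_⟩
  obtain ⟨hP, hlog⟩ := hk₀ k ℓ hk hℓ fun i hi => MMLower.clusterSize_pow (hs i hi)
  refine ⟨fun G hG => MMLower.exists_perfectMatching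
    (fun i hi => MMLower.even_clusterSize (hs i hi))
    fun u v huv h => MMLower.adj_of_mem_support_hardMM hG huv h, fun π _ C => ⟨?_, ?_⟩⟩
  · intro r hr
    have h2r : 2 * r ≤ ℓ := by
      have : (2 : ℝ) * r ≤ ℓ := by linarith
      exact_mod_cast this
    have hpos := hP.pos
    exact hP.highProb_le_prob π C (by omega) _ fun G M hG hM =>
      hP.not_isMaximal hG (by omega) hM
  · intro r j hr hrj hj
    refine hP.highProb_le_prob π C (by omega) _ fun G M _ hM => ?_
    rw [Set.mem_ofPred_eq, MMLower.activeInLevel_eq]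
    -- The invariant gives the stronger loss `5 * r / log² n`, without the factor `ℓ`.
    refine le_trans ?_ (hP.card_activeLevel_ge hM hrj hj)
    have hL := hP.log_sq_pos
    have hℓ1 : (1 : ℝ) ≤ ℓ := by exact_mod_cast hP.pos
    gcongr
    nlinarith
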